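/- Let $r,n\ge 0$ be integers and let $L_1,\dots,L_n$ be linear forms on $\mathbb Q^r$; for a field $K\supseteq\mathbb Q$, regard them also as linear forms on $K^r$. For a subset $\Omega\subseteq K^r$ let $U(\Omega)\subseteq \mathrm{GL}_r(K)$ be its stabilizer, acting on linear forms on $K^r$ by $u\cdot\ell=\ell\circ u^{-1}$. Suppose that the system $L_1(X)\overset{d}{=}\cdots\overset{d}{=}L_n(X)$ is ellipsoidal over $\mathbb Q$ in the following sense. (a) For every prime $p$ we are given a lattice $\Omega_p\subseteq\mathbb Q_p^r$ (a finitely generated $\mathbb Z_p$-submodule spanning $\mathbb Q_p^r$) such that $L_1,\dots,L_n$ lie in a single orbit of $U(\Omega_p)$, and $\Omega_p=\mathbb Z_p^r$ for all but finitely many $p$. (b) $Q$ is a positive definite quadratic form on $\mathbb R^r$ that is defined over $\mathbb Q$ (it extends a quadratic form on $\mathbb Q^r$), $\Omega_{\mathbb R}$ is the solid ellipsoid with boundary $Q(x)=1$ (either the closed one $\{x: Q(x)\le 1\}$ or the open one $\{x: Q(x)<1\}$), and $L_1,\dots,L_n$ lie in a single orbit of $U(\Omega_{\mathbb R})$. Let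 $\Lambda$ be the set of $x\in\mathbb Q^r$ that lie in $\Omega_p$ for every prime $p$, and for real $D>0$ let $\Omega_{\mathbb Q}(D)=\Lambda\cap D\,\Omega_{\mathbb R}$. Then $\Omega_{\mathbb Q}(D)$ is finite and non-empty for every $D>0$, and there is a constant $C$ (independent of $D$, $i$, $j$ and $y$) such that for every real $D>0$, all $i,j\in\{1,\dots,n\}$ and all $y\in\mathbb Q$, a random variable $X$ uniformly distributed on $\Omega_{\mathbb Q}(D)$ satisfies $$\bigl|\Pr(L_i(X)=y)-\Pr(L_j(X)=y)\bigr|\le C D^{-2}.$$ -/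

import Mathlib

open scoped Pointwise

namespace NonDet

/-- The coordinatewise embedding `ℚ^r → K^r` for a field `K` containing `ℚ`. -/
def coordEmb (K : Type*) [Field K] [Algebra ℚ K] {r : ℕ} (x : Fin r → ℚ) : Fin r → K :=
  fun k => algebraMap ℚ K (x k)

/-- The extension of scalars to `K` of a linear form on `ℚ^r`: the linear form on `K^r` with the
same coefficients. -/
def formOver (K : Type*) [Field K] [Algebra ℚ K] {r : ℕ} (L : Module.Dual ℚ (Fin r → ℚ)) :
    Module.Dual K (Fin r → K) :=
  ∑ k : Fin r, algebraMap ℚ K (L (Pi.single k 1)) • LinearMap.proj k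

theorem formOver_coordEmb (K : Type*) [Field K] [Algebra ℚ K] {r : ℕ}
    (L : Module.Dual ℚ (Fin r → ℚ)) (x : Fin r → ℚ) :
    formOver K L (coordEmb K x) = algebraMap ℚ K (L x) := by
  conv_rhs => rw [LinearMap.pi_apply_eq_sum_univ L x]
  simp only [formOver, coordEmb, LinearMap.sum_apply, LinearMap.smul_apply, LinearMap.proj_apply,
    smul_eq_mul, map_sum, map_mul]
  refine Finset.sum_congr rfl fun k _ => ?_
  have h : (Pi.single k 1 : Fin r → ℚ) = fun j => if k = j then 1 else 0 := by
    funext j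
    simp [Pi.single_apply, eq_comm]
  rw [h, mul_comm]

/-- The unitary group `U(Ω)`: the stabilizer of `Ω ⊆ K^r` in `GL_r(K)`. -/
def unitaryGroup {K : Type*} [Field K] {r : ℕ} (Ω : Set (Fin r → K)) :
    Subgroup ((Fin r → K) ≃ₗ[K] (Fin r → K)) :=
  MulAction.stabilizer ((Fin r → K) ≃ₗ[K] (Fin r → K)) Ω

/-- The linear forms `ℓ i` on `K^r` lie in a single orbit of `U(Ω)`, acting on linear forms by the
dual action `(u, ℓ) ↦ ℓ ∘ u⁻¹`. -/
def InSingleOrbit {K : Type*} [Field K] {r n : ℕ} (Ω : Set (Fin r → K))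
    (ℓ : Fin n → Module.Dual K (Fin r → K)) : Prop :=
  ∀ i j, ∃ u ∈ unitaryGroup Ω, ℓ j = (ℓ i).comp (u⁻¹ : (Fin r → K) ≃ₗ[K] (Fin r → K)).toLinearMap

/-- The standard lattice `ℤ_p^r` in `ℚ_p^r`. -/
noncomputable def standardLattice (p : ℕ) [Fact p.Prime] (r : ℕ) : Submodule ℤ_[p] (Fin r → ℚ_[p]) :=
  Submodule.pi Set.univ fun _ => (1 : Submodule ℤ_[p] ℚ_[p])

/-- A real quadratic form on `ℝ^r` is defined over `ℚ` if it extends a quadratic form on `ℚ^r`. -/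
def IsDefinedOverRat {r : ℕ} (Q : QuadraticForm ℝ (Fin r → ℝ)) : Prop :=
  ∃ Q₀ : QuadraticForm ℚ (Fin r → ℚ), ∀ x : Fin r → ℚ, Q (coordEmb ℝ x) = (Q₀ x : ℝ)

/-- `Ω` is the solid ellipsoid with boundary `Q(x) = 1`, taken either with or without its
boundary. -/
def IsEllipsoidOf {r : ℕ} (Q : QuadraticForm ℝ (Fin r → ℝ)) (Ω : Set (Fin r → ℝ)) : Prop :=
  Ω = {x | Q x ≤ 1} ∨ Ω = {x | Q x < 1}

/-- The lattice `Λ ⊆ ℚ^r` of all `x` that lie in `Ω_p` for every prime `p`. -/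
def globalLattice {r : ℕ} (Ω : ∀ (p : ℕ) [Fact p.Prime], Submodule ℤ_[p] (Fin r → ℚ_[p])) :
    AddSubgroup (Fin r → ℚ) where
  carrier := {x | ∀ (p : ℕ) [Fact p.Prime], coordEmb ℚ_[p] x ∈ Ω p}
  zero_mem' := by
    intro p _
    have h : coordEmb ℚ_[p] (0 : Fin r → ℚ) = 0 := by
      funext k
      simp [coordEmb]
    rw [h]
    exact (Ω p).zero_mem
  add_mem' := by
    intro x y hx hy p _
    have h : coordEmb ℚ_[p] (x + y) = coordEmb ℚ_[p] x + coordEmb ℚ_[p] y := by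
      funext k
      simp [coordEmb]
    rw [h]
    exact (Ω p).add_mem (hx p) (hy p)
  neg_mem' := by
    intro x hx p _
    have h : coordEmb ℚ_[p] (-x) = -coordEmb ℚ_[p] x := by
      funext k
      simp [coordEmb]
    rw [h]
    exact (Ω p).neg_mem (hx p)

/-- `Ω_ℚ(D)`: the points of `Λ` that lie in the dilated ellipsoid `D Ω_ℝ`. -/
def ratPoints {r : ℕ} (Ω : ∀ (p : ℕ) [Fact p.Prime], Submodule ℤ_[p] (Fin r → ℚ_[p]))
    (Ωreal : Set (Fin r → ℝ)) (D : ℝ) : Set (Fin r → ℚ) :=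
  {x | x ∈ globalLattice Ω ∧ coordEmb ℝ x ∈ D • Ωreal}

end NonDet

/-!
Let `Λ` be the lattice of the `x ∈ ℚ^r` lying in every `Ω_p`. The orbit conditions at the primes
force `L_i(Λ) = L_j(Λ)`: for `x ∈ Λ` and every `p`, the value `L_i(x)` is attained by `L_j` on the
open set `Ω_p`, hence at a rational point `z` of `Ω_p` because `ℚ` is dense in `ℚ_p`, and some
multiple of `z` by an integer prime to `p` lies in `Λ`.

If `gℤ` is this common image, with `g ≠ 0`, then `Λ` has for each form `ℓ` a basis in which `ℓ` is
`g` times the first coordinate, so that the fibre `ℓ = tg` becomes the set of integer points of a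
slice of a convex body of size `O(D)` in dimension `r - 1`. By Davenport's principle there are
`vol_{r-1} + O(D^{r-2})` of these. The orbit condition at the real place carries the slices for
`L_i` to those for `L_j` by a linear map of determinant `±1`, as it preserves a bounded
neighbourhood of `0`, so the two volumes agree. Since `Λ ∩ D Ω_ℝ` has at least `c D^r` points, the
probabilities differ by `O(D^{-2})`.
-/

namespace NonDet

open scoped Topology
open MeasureTheory Metric Module

/-! ### Integer points of a convex body -/

section Convex

variable {E : Type*} [NormedAddCommGroup E] [NormedSpace ℝ E] [MeasurableSpace E] [BorelSpace E]
  [FiniteDimensional ℝ E] (μ : Measure E) [μ.IsAddHaarMeasure] {A : Set E}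

theorem integrable_indicator_one_of_convex (hc : Convex ℝ A) (hb : Bornology.IsBounded A) :
    Integrable (A.indicator (1 : E → ℝ)) μ :=
  IntegrableOn.integrable_indicator₀ (integrableOn_const hb.measure_lt_top.ne)
    (hc.nullMeasurableSet μ)

theorem integral_indicator_one_of_convex (hc : Convex ℝ A) :
    ∫ x, A.indicator (1 : E → ℝ) x ∂μ = μ.real A := by
  simp [integral_indicator₀ (hc.nullMeasurableSet μ)]

end Convex

theorem abs_ncard_int_sub_volume_le_one {J : Set ℝ} (hJ : J.OrdConnected)
    (hbdd : Bornology.IsBounded J) : |({n : ℤ | (n : ℝ) ∈ J}.ncard : ℝ) - volume.real J| ≤ 1 := by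
  rcases J.eq_empty_or_nonempty with rfl | hne
  · simp
  set a := sInf J
  set b := sSup J
  have hsub : J ⊆ Set.Icc a b := hbdd.subset_Icc_sInf_sSup
  have hsup : Set.Ioo a b ⊆ J := by
    intro x hx
    obtain ⟨u, hu, hux⟩ := exists_lt_of_csInf_lt hne hx.1
    obtain ⟨v, hv, hxv⟩ := exists_lt_of_lt_csSup hne hx.2
    exact hJ.out hu hv ⟨hux.le, hxv.le⟩
  have hab : a ≤ b := hne.elim fun x hx => (hsub hx).1.trans (hsub hx).2
  have hvol : volume.real J = b - a := by
    refine le_antisymm ?_ ?_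
    · simpa [hab] using measureReal_mono (μ := volume) hsub measure_Icc_lt_top.ne
    · simpa [hab] using measureReal_mono (μ := volume) hsup hbdd.measure_lt_top.ne
  have hupper : {n : ℤ | (n : ℝ) ∈ J} ⊆ Finset.Icc ⌈a⌉ ⌊b⌋ := fun n hn =>
    Finset.mem_coe.2 <| Finset.mem_Icc.2 ⟨Int.ceil_le.2 (hsub hn).1, Int.le_floor.2 (hsub hn).2⟩
  have hlower : (Finset.Ioo ⌊a⌋ ⌈b⌉ : Set ℤ) ⊆ {n : ℤ | (n : ℝ) ∈ J} := by
    rw [Finset.coe_Ioo]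
    exact fun n hn => hsup ⟨Int.floor_lt.1 hn.1, Int.lt_ceil.1 hn.2⟩
  have hcard_le := Set.ncard_le_ncard hupper
  have hle_card := Set.ncard_le_ncard hlower ((Finset.finite_toSet _).subset hupper)
  rw [Set.ncard_coe_finset, Int.card_Icc] at hcard_le
  rw [Set.ncard_coe_finset, Int.card_Ioo] at hle_card
  have hcard_le' : ({n : ℤ | (n : ℝ) ∈ J}.ncard : ℝ) ≤ max ((⌊b⌋ : ℝ) + 1 - ⌈a⌉) 0 := by
    exact_mod_cast (by omega : ({n : ℤ | (n : ℝ) ∈ J}.ncard : ℤ) ≤ max (⌊b⌋ + 1 - ⌈a⌉) 0)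
  have hle_card' : (⌈b⌉ : ℝ) - ⌊a⌋ - 1 ≤ ({n : ℤ | (n : ℝ) ∈ J}.ncard : ℝ) := by
    exact_mod_cast (by omega : ⌈b⌉ - ⌊a⌋ - 1 ≤ ({n : ℤ | (n : ℝ) ∈ J}.ncard : ℤ))
  have hmax : max ((⌊b⌋ : ℝ) + 1 - ⌈a⌉) 0 ≤ b - a + 1 :=
    max_le (by linarith [Int.floor_le b, Int.le_ceil a]) (by linarith)
  rw [hvol, abs_le]
  constructor <;> linarith [Int.floor_le a, Int.le_ceil b]

/-- The integer points of a subset of `ℝ^m`. -/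
def intPoints {m : ℕ} (K : Set (Fin m → ℝ)) : Set (Fin m → ℤ) :=
  {z | (fun k => (z k : ℝ)) ∈ K}

/-- The slice of `K ⊆ ℝ^(m+1)` on which the first coordinate is `t`, as a subset of `ℝ^m`. -/
def headSlice {m : ℕ} (K : Set (Fin (m + 1) → ℝ)) (t : ℝ) : Set (Fin m → ℝ) :=
  {x | (Fin.cons t x : Fin (m + 1) → ℝ) ∈ K}

/-- The slice of `K ⊆ ℝ^(m+1)` on which the last `m` coordinates are `x`, as a subset of `ℝ`. -/
def tailSlice {m : ℕ} (K : Set (Fin (m + 1) → ℝ)) (x : Fin m → ℝ) : Set ℝ :=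
  {t | (Fin.cons t x : Fin (m + 1) → ℝ) ∈ K}

theorem intPoints_finite {m : ℕ} {K : Set (Fin m → ℝ)} (hK : Bornology.IsBounded K) :
    (intPoints K).Finite := by
  obtain ⟨R, hR⟩ := hK.subset_closedBall 0
  refine (Set.Finite.pi' (t := fun _ => Set.Icc ⌈-R⌉ ⌊R⌋) fun _ => Set.finite_Icc _ _).subset ?_
  intro z hz k
  have hzk : |(z k : ℝ)| ≤ R :=
    (norm_le_pi_norm (fun k => (z k : ℝ)) k).trans (mem_closedBall_zero_iff.1 (hR hz))
  exact ⟨Int.ceil_le.2 (abs_le.1 hzk).1, Int.le_floor.2 (abs_le.1 hzk).2⟩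

section Slices

variable {m : ℕ} {K : Set (Fin (m + 1) → ℝ)} {R : ℝ}

theorem finCons_mem_closedBall_zero_iff (hR : 0 ≤ R) {t : ℝ} {x : Fin m → ℝ} :
    (Fin.cons t x : Fin (m + 1) → ℝ) ∈ closedBall 0 R ↔
      t ∈ Set.Icc (-R) R ∧ x ∈ closedBall 0 R := by
  simp [pi_norm_le_iff_of_nonneg hR, Fin.forall_fin_succ, abs_le]

theorem headSlice_subset_closedBall (hR : 0 ≤ R) (hK : K ⊆ closedBall 0 R) (t : ℝ) :
    headSlice K t ⊆ closedBall 0 R :=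
  fun _ hx => ((finCons_mem_closedBall_zero_iff hR).1 (hK hx)).2

theorem tailSlice_subset_Icc (hR : 0 ≤ R) (hK : K ⊆ closedBall 0 R) (x : Fin m → ℝ) :
    tailSlice K x ⊆ Set.Icc (-R) R :=
  fun _ ht => ((finCons_mem_closedBall_zero_iff hR).1 (hK ht)).1

theorem tailSlice_eq_empty (hR : 0 ≤ R) (hK : K ⊆ closedBall 0 R) {x : Fin m → ℝ}
    (hx : x ∉ closedBall 0 R) : tailSlice K x = ∅ :=
  Set.eq_empty_of_forall_notMem fun _ ht =>
    hx ((finCons_mem_closedBall_zero_iff hR).1 (hK ht)).2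

theorem convex_headSlice (hK : Convex ℝ K) (t : ℝ) : Convex ℝ (headSlice K t) := by
  intro x hx y hy a b ha hb hab
  have h := hK hx hy ha hb hab
  rwa [← Matrix.vecCons, ← Matrix.vecCons, Matrix.smul_cons, Matrix.smul_cons,
    Matrix.cons_add_cons, Convex.combo_self hab] at h

theorem convex_tailSlice (hK : Convex ℝ K) (x : Fin m → ℝ) : Convex ℝ (tailSlice K x) := by
  intro s hs t ht a b ha hb hab
  have h := hK hs ht ha hb hab
  rwa [← Matrix.vecCons, ← Matrix.vecCons, Matrix.smul_cons, Matrix.smul_cons,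
    Matrix.cons_add_cons, Convex.combo_self hab] at h

theorem mem_intPoints_finCons_iff {n : ℤ} {z : Fin m → ℤ} :
    (Fin.cons n z : Fin (m + 1) → ℤ) ∈ intPoints K ↔ z ∈ intPoints (headSlice K n) := by
  have hcast : (fun k => ((Fin.cons n z : Fin (m + 1) → ℤ) k : ℝ)) =
      Fin.cons (n : ℝ) fun k => (z k : ℝ) := by
    funext k
    refine Fin.cases ?_ (fun k => ?_) k <;> simp
  simp only [intPoints, headSlice, Set.mem_ofPred_eq, hcast]

theorem image_finCons_intPoints_headSlice (n : ℤ) :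
    (fun z => (Fin.cons n z : Fin (m + 1) → ℤ)) '' intPoints (headSlice K n) =
      {z ∈ intPoints K | z 0 = n} := by
  ext z
  constructor
  · rintro ⟨w, hw, rfl⟩
    exact ⟨mem_intPoints_finCons_iff.2 hw, Fin.cons_zero _ _⟩
  · rintro ⟨hz, rfl⟩
    rw [← Fin.cons_self_tail z, mem_intPoints_finCons_iff] at hz
    exact ⟨Fin.tail z, hz, Fin.cons_self_tail z⟩

theorem ncard_intPoints_headSlice (n : ℤ) :
    (intPoints (headSlice K n)).ncard = {z ∈ intPoints K | z 0 = n}.ncard := by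
  rw [← image_finCons_intPoints_headSlice, Set.ncard_image_of_injective _
    (Fin.cons_right_injective (α := fun _ => ℤ) n)]

theorem ncard_intPoints_eq_sum (hR : 0 ≤ R) (hK : K ⊆ closedBall 0 R) :
    (intPoints K).ncard = ∑ n ∈ Finset.Icc ⌈-R⌉ ⌊R⌋, (intPoints (headSlice K n)).ncard := by
  have hfin := intPoints_finite (isBounded_closedBall.subset hK)
  have hmaps : ∀ z ∈ hfin.toFinset, z 0 ∈ Finset.Icc ⌈-R⌉ ⌊R⌋ := by
    intro z hz
    rw [hfin.mem_toFinset, ← Fin.cons_self_tail z, mem_intPoints_finCons_iff] at hz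
    have h := ((finCons_mem_closedBall_zero_iff hR).1 (hK hz)).1
    exact Finset.mem_Icc.2 ⟨Int.ceil_le.2 h.1, Int.le_floor.2 h.2⟩
  rw [Set.ncard_eq_toFinset_card _ hfin, Finset.card_eq_sum_card_fiberwise hmaps]
  refine Finset.sum_congr rfl fun n _ => ?_
  rw [ncard_intPoints_headSlice, ← Set.ncard_coe_finset]
  congr 1
  ext z
  simp

theorem coe_piFinSuccAbove_zero_symm (m : ℕ) :
    ⇑(MeasurableEquiv.piFinSuccAbove (fun _ : Fin (m + 1) => ℝ) 0).symm =
      fun p => Fin.cons p.1 p.2 :=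
  funext fun p => Fin.insertNth_zero (α := fun _ => ℝ) p.1 p.2

theorem measurePreserving_finCons (m : ℕ) :
    MeasurePreserving (fun p : ℝ × (Fin m → ℝ) => (Fin.cons p.1 p.2 : Fin (m + 1) → ℝ)) :=
  coe_piFinSuccAbove_zero_symm m ▸ (volume_preserving_piFinSuccAbove _ 0).symm

theorem integrable_indicator_finCons (hc : Convex ℝ K) (hb : Bornology.IsBounded K) :
    Integrable fun p : ℝ × (Fin m → ℝ) =>
      K.indicator (1 : (Fin (m + 1) → ℝ) → ℝ) (Fin.cons p.1 p.2) :=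
  (measurePreserving_finCons m).integrable_comp_of_integrable
    (integrable_indicator_one_of_convex volume hc hb)

theorem integral_indicator_finCons (hc : Convex ℝ K) (x : Fin m → ℝ) :
    ∫ t : ℝ, K.indicator (1 : (Fin (m + 1) → ℝ) → ℝ) (Fin.cons t x) =
      volume.real (tailSlice K x) :=
  integral_indicator_one_of_convex volume (convex_tailSlice hc x)

theorem integrable_volumeReal_tailSlice (hc : Convex ℝ K) (hb : Bornology.IsBounded K) :
    Integrable fun x : Fin m → ℝ => volume.real (tailSlice K x) := by
  simp only [← integral_indicator_finCons hc]
  exact (integrable_indicator_finCons hc hb).integral_prod_right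

theorem integral_volumeReal_tailSlice (hc : Convex ℝ K) (hb : Bornology.IsBounded K) :
    ∫ x : Fin m → ℝ, volume.real (tailSlice K x) = volume.real K := by
  simp only [← integral_indicator_finCons hc]
  rw [← integral_prod_symm _ (integrable_indicator_finCons hc hb),
    ← integral_indicator_one_of_convex volume hc]
  exact (measurePreserving_finCons m).integral_comp
    (coe_piFinSuccAbove_zero_symm m ▸ MeasurableEquiv.measurableEmbedding _) _

theorem ncard_int_tailSlice_eq_sum (hR : 0 ≤ R) (hK : K ⊆ closedBall 0 R) (x : Fin m → ℝ) :
    ({n : ℤ | (n : ℝ) ∈ tailSlice K x}.ncard : ℝ) =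
      ∑ n ∈ Finset.Icc ⌈-R⌉ ⌊R⌋, (headSlice K n).indicator (1 : (Fin m → ℝ) → ℝ) x := by
  classical
  have hfilter : {n : ℤ | (n : ℝ) ∈ tailSlice K x} =
      ((Finset.Icc ⌈-R⌉ ⌊R⌋).filter fun n : ℤ => x ∈ headSlice K n : Finset ℤ) := by
    ext n
    simp only [Set.mem_ofPred_eq, Finset.coe_filter, Finset.mem_Icc]
    refine ⟨fun h => ⟨?_, h⟩, fun h => h.2⟩
    have hn := tailSlice_subset_Icc hR hK x h
    exact ⟨Int.ceil_le.2 hn.1, Int.le_floor.2 hn.2⟩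
  rw [hfilter, Set.ncard_coe_finset, Finset.card_filter]
  push_cast
  exact Finset.sum_congr rfl fun n _ => by simp [Set.indicator_apply]

theorem integrable_ncard_int_tailSlice (hc : Convex ℝ K) (hR : 0 ≤ R) (hK : K ⊆ closedBall 0 R) :
    Integrable fun x : Fin m → ℝ => ({n : ℤ | (n : ℝ) ∈ tailSlice K x}.ncard : ℝ) := by
  simp only [ncard_int_tailSlice_eq_sum hR hK]
  exact integrable_finsetSum _ fun n _ => integrable_indicator_one_of_convex volume
    (convex_headSlice hc n) (isBounded_closedBall.subset (headSlice_subset_closedBall hR hK n))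

theorem integral_ncard_int_tailSlice (hc : Convex ℝ K) (hR : 0 ≤ R) (hK : K ⊆ closedBall 0 R) :
    ∫ x : Fin m → ℝ, ({n : ℤ | (n : ℝ) ∈ tailSlice K x}.ncard : ℝ) =
      ∑ n ∈ Finset.Icc ⌈-R⌉ ⌊R⌋, volume.real (headSlice K n) := by
  simp only [ncard_int_tailSlice_eq_sum hR hK]
  rw [integral_finsetSum _ fun (n : ℤ) _ => integrable_indicator_one_of_convex volume
    (convex_headSlice hc n) (isBounded_closedBall.subset (headSlice_subset_closedBall hR hK n))]
  exact Finset.sum_congr rfl fun n _ =>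
    integral_indicator_one_of_convex volume (convex_headSlice hc n)

theorem abs_sum_volumeReal_headSlice_sub_le (hc : Convex ℝ K) (hR : 0 ≤ R)
    (hK : K ⊆ closedBall 0 R) :
    |∑ n ∈ Finset.Icc ⌈-R⌉ ⌊R⌋, volume.real (headSlice K n) - volume.real K| ≤ (2 * R) ^ m := by
  have hvol : volume.real (closedBall (0 : Fin m → ℝ) R) = (2 * R) ^ m := by
    simp [Measure.real, Real.volume_pi_closedBall _ hR, hR]
  have hb : Bornology.IsBounded K := isBounded_closedBall.subset hK
  have hball : Convex ℝ (closedBall (0 : Fin m → ℝ) R) := convex_closedBall 0 R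
  rw [← integral_ncard_int_tailSlice hc hR hK, ← integral_volumeReal_tailSlice hc hb,
    ← integral_sub (integrable_ncard_int_tailSlice hc hR hK)
      (integrable_volumeReal_tailSlice hc hb), ← hvol,
    ← integral_indicator_one_of_convex volume hball, ← Real.norm_eq_abs]
  refine norm_integral_le_of_norm_le
    (integrable_indicator_one_of_convex volume hball isBounded_closedBall)
    (Filter.Eventually.of_forall fun x => ?_)
  by_cases hx : x ∈ closedBall 0 R
  · rw [Set.indicator_of_mem hx, Real.norm_eq_abs]
    exact abs_ncard_int_sub_volume_le_one (convex_tailSlice hc x).ordConnected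
      ((isBounded_Icc (-R) R).subset (tailSlice_subset_Icc hR hK x))
  · simp [Set.indicator_of_notMem hx, tailSlice_eq_empty hR hK hx]

end Slices

theorem card_Icc_ceil_floor_le {R : ℝ} (hR : 0 ≤ R) :
    ((Finset.Icc ⌈-R⌉ ⌊R⌋).card : ℝ) ≤ 2 * R + 1 := by
  have hcard : ((Finset.Icc ⌈-R⌉ ⌊R⌋).card : ℝ) = max (⌊R⌋ + 1 - ⌈-R⌉ : ℝ) 0 := by
    exact_mod_cast (by simp : ((Finset.Icc ⌈-R⌉ ⌊R⌋).card : ℤ) = max (⌊R⌋ + 1 - ⌈-R⌉) 0)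
  rw [hcard]
  exact max_le (by linarith [Int.floor_le R, Int.le_ceil (-R)]) (by linarith)

/-- Induction on the dimension: the integer points are counted slice by slice, and the sum over
the slices is compared with the volume one line in the first direction at a time. -/
theorem abs_ncard_intPoints_sub_volume_le {m : ℕ} {K : Set (Fin m → ℝ)} {R : ℝ} (hR : 0 ≤ R)
    (hc : Convex ℝ K) (hK : K ⊆ closedBall 0 R) :
    |((intPoints K).ncard : ℝ) - volume.real K| ≤ m * (2 * R + 1) ^ (m - 1) := by
  induction m with
  | zero =>
    rcases K.eq_empty_or_nonempty with rfl | hne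
    · simp [intPoints]
    · rw [Subsingleton.eq_univ_of_nonempty hne]
      simp [intPoints, Measure.real, Measure.volume_pi_eq_dirac (0 : Fin 0 → ℝ)]
  | succ m ih =>
    set T := Finset.Icc ⌈-R⌉ ⌊R⌋
    have hslices : |((intPoints K).ncard : ℝ) - ∑ n ∈ T, volume.real (headSlice K n)| ≤
        m * (2 * R + 1) ^ m := by
      rw [ncard_intPoints_eq_sum hR hK, Nat.cast_sum, ← Finset.sum_sub_distrib]
      calc _ ≤ _ := Finset.abs_sum_le_sum_abs _ _
        _ ≤ T.card • (m * (2 * R + 1) ^ (m - 1)) := Finset.sum_le_card_nsmul T _ _ fun n _ =>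
          ih (convex_headSlice hc n) (headSlice_subset_closedBall hR hK n)
        _ ≤ (2 * R + 1) * (m * (2 * R + 1) ^ (m - 1)) := by
          rw [nsmul_eq_mul]
          gcongr
          exact card_Icc_ceil_floor_le hR
        _ = m * (2 * R + 1) ^ m := by
          cases m with
          | zero => simp
          | succ m => rw [Nat.add_sub_cancel]; ring
    have hsum : |∑ n ∈ T, volume.real (headSlice K n) - volume.real K| ≤ (2 * R + 1) ^ m :=
      (abs_sum_volumeReal_headSlice_sub_le hc hR hK).trans (by gcongr; linarith)
    calc _ ≤ _ := abs_sub_le _ (∑ n ∈ T, volume.real (headSlice K n)) _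
      _ ≤ m * (2 * R + 1) ^ m + (2 * R + 1) ^ m := add_le_add hslices hsum
      _ = (m + 1 : ℕ) * (2 * R + 1) ^ (m + 1 - 1) := by
        rw [Nat.add_sub_cancel]
        push_cast
        ring

theorem abs_ncard_intPoints_sub_volume_le_mul_pow {m : ℕ} {K : Set (Fin m → ℝ)} {R D : ℝ}
    (hR : 0 ≤ R) (hD : 1 ≤ D) (hc : Convex ℝ K) (hK : K ⊆ closedBall 0 (D * R)) :
    |((intPoints K).ncard : ℝ) - volume.real K| ≤ m * (2 * R + 1) ^ (m - 1) * D ^ (m - 1) := by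
  refine (abs_ncard_intPoints_sub_volume_le (by positivity) hc hK).trans ?_
  rw [mul_assoc, ← mul_pow]
  gcongr
  linarith

theorem pow_le_ncard_intPoints {m : ℕ} {K : Set (Fin m → ℝ)} {s : ℝ} (hs : 0 ≤ s)
    (hK : Bornology.IsBounded K) (hsK : closedBall 0 s ⊆ K) :
    s ^ m ≤ ((intPoints K).ncard : ℝ) := by
  set B : Finset (Fin m → ℤ) := Finset.Icc (fun _ => -⌊s⌋) fun _ => ⌊s⌋
  have hB : (B : Set (Fin m → ℤ)) ⊆ intPoints K := by
    intro z hz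
    rw [Finset.mem_coe, Finset.mem_Icc] at hz
    refine hsK (mem_closedBall_zero_iff.2 ((pi_norm_le_iff_of_nonneg hs).2 fun k => ?_))
    have hlower : (-⌊s⌋ : ℝ) ≤ z k := by exact_mod_cast hz.1 k
    have hupper : (z k : ℝ) ≤ ⌊s⌋ := by exact_mod_cast hz.2 k
    rw [Real.norm_eq_abs, abs_le]
    constructor <;> linarith [Int.floor_le s]
  have hcard : (B.card : ℝ) = (2 * ⌊s⌋ + 1) ^ m := by
    have hside : (((⌊s⌋ + 1 + ⌊s⌋).toNat : ℤ) : ℝ) = 2 * ⌊s⌋ + 1 := by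
      rw [Int.toNat_of_nonneg (by have := Int.floor_nonneg.2 hs; omega)]
      push_cast
      ring
    rw [Int.cast_natCast] at hside
    simp [B, Pi.card_Icc, hside]
  calc s ^ m ≤ (2 * ⌊s⌋ + 1) ^ m := by
        have : (0 : ℝ) ≤ ⌊s⌋ := by exact_mod_cast Int.floor_nonneg.2 hs
        gcongr
        linarith [Int.lt_floor_add_one s]
    _ = B.card := hcard.symm
    _ ≤ (intPoints K).ncard := by
        exact_mod_cast Set.ncard_coe_finset B ▸ Set.ncard_le_ncard hB (intPoints_finite hK)

section Shear

variable {m : ℕ}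

theorem mulVec_finCons {A : Matrix (Fin (m + 1)) (Fin (m + 1)) ℝ}
    (hA : ∀ v, A.mulVec v 0 = v 0) (t : ℝ) (x : Fin m → ℝ) :
    A.mulVec (Fin.cons t x) =
      Fin.cons t ((A.submatrix Fin.succ Fin.succ).mulVec x + fun k => A k.succ 0 * t) := by
  funext k
  refine Fin.cases ?_ (fun k => ?_) k
  · simpa using hA (Fin.cons t x)
  · simp [Matrix.mulVec, dotProduct, Fin.sum_univ_succ, add_comm]

theorem det_submatrix_succ {A : Matrix (Fin (m + 1)) (Fin (m + 1)) ℝ}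
    (hA : ∀ v, A.mulVec v 0 = v 0) : (A.submatrix Fin.succ Fin.succ).det = A.det := by
  have hrow : ∀ k, A 0 k = if k = 0 then 1 else 0 := fun k => by
    simpa [Pi.single_apply, eq_comm] using hA (Pi.single k 1)
  rw [Matrix.det_succ_row_zero A, Fin.sum_univ_succ]
  simp [hrow, Fin.succ_ne_zero]

theorem volumeReal_headSlice_preimage {S : (Fin (m + 1) → ℝ) →ₗ[ℝ] Fin (m + 1) → ℝ}
    (hdet : |S.det| = 1) (hS : ∀ v, S v 0 = v 0) (K : Set (Fin (m + 1) → ℝ)) (t : ℝ) :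
    volume.real (headSlice (S ⁻¹' K) t) = volume.real (headSlice K t) := by
  set A := LinearMap.toMatrix' S
  have hA : ∀ v, A.mulVec v = S v := fun v => by rw [← Matrix.toLin'_apply, Matrix.toLin'_toMatrix']
  have hA0 : ∀ v, A.mulVec v 0 = v 0 := fun v => by rw [hA, hS]
  set B := Matrix.toLin' (A.submatrix Fin.succ Fin.succ)
  have hB : |B.det| = 1 := by
    rw [LinearMap.det_toLin', det_submatrix_succ hA0, LinearMap.det_toMatrix', hdet]
  have hslice : headSlice (S ⁻¹' K) t =
      B ⁻¹' ((· + fun k => A k.succ 0 * t) ⁻¹' headSlice K t) := by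
    ext x
    change S (Fin.cons t x) ∈ K ↔ _
    rw [← hA, mulVec_finCons hA0]
    rfl
  have hB0 : B.det ≠ 0 := abs_ne_zero.1 (hB ▸ one_ne_zero)
  rw [hslice, Measure.real, Measure.addHaar_preimage_linearMap _ hB0, abs_inv, hB,
    measure_preimage_add_right]
  simp [Measure.real]

end Shear

/-! ### Lattice points of a convex body on hyperplanes -/

theorem exists_basis_coord_zero_eq {R M : Type*} [CommRing R] [IsDomain R]
    [IsPrincipalIdealRing R] [AddCommGroup M] [Module R M] [Module.Free R M] [Module.Finite R M]
    {m : ℕ} (hm : finrank R M = m + 1) {f : M →ₗ[R] R} (hf : Function.Surjective f) :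
    ∃ b : Basis (Fin (m + 1)) R M, b.coord 0 = f := by
  obtain ⟨y, hy⟩ := hf 1
  have hker : finrank R f.ker = m := by
    have h := Submodule.finrank_quotient_add_finrank f.ker
    rw [(f.quotKerEquivOfSurjective hf).finrank_eq, finrank_self] at h
    omega
  have hli : ∀ c : R, ∀ x ∈ f.ker, c • y + x = 0 → c = 0 := fun c x hx h => by
    simpa [hy, LinearMap.mem_ker.1 hx] using congrArg f h
  have hsp : ∀ z : M, ∃ c : R, z + c • y ∈ f.ker := fun z => ⟨-f z, by simp [hy]⟩
  let b := Basis.mkFinCons y (finBasisOfFinrankEq R f.ker hker) hli hsp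
  refine ⟨b, b.ext fun i => ?_⟩
  rw [Basis.coord_apply, b.repr_self, Basis.coe_mkFinCons]
  refine Fin.cases ?_ (fun k => ?_) i
  · simp [hy]
  · simp

section ZLattice

variable {E : Type*} [NormedAddCommGroup E] [NormedSpace ℝ E]

section Basis

variable {ι : Type*} [Fintype ι] {m : ℕ}

theorem abs_det_eq_one_of_span_eq [DecidableEq ι] {β β' : Basis ι ℝ E}
    (h : Submodule.span ℤ (Set.range β) = Submodule.span ℤ (Set.range β')) :
    |β'.det β| = 1 := by
  have := β.finiteDimensional_of_finite
  borelize E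
  have hβ := ZSpan.isAddFundamentalDomain' β (Measure.addHaar (G := E))
  have hβ' := ZSpan.isAddFundamentalDomain' β' (Measure.addHaar (G := E))
  rw [← h] at hβ'
  have hdet := ZSpan.measureReal_fundamentalDomain β Measure.addHaar β'
  have : Countable (Submodule.span ℤ (Set.range β)).toAddSubgroup :=
    inferInstanceAs (Countable (Submodule.span ℤ (Set.range β)))
  rw [measureReal_def, hβ.measure_eq hβ', ← measureReal_def] at hdet
  have hne : Measure.addHaar.real (ZSpan.fundamentalDomain β') ≠ 0 :=
    (measureReal_ne_zero_iff (ZSpan.fundamentalDomain_isBounded β').measure_lt_top.ne).2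
      (ZSpan.measure_fundamentalDomain_ne_zero β')
  exact (mul_eq_right₀ hne).1 hdet.symm

theorem image_intPoints_preimage (β : Basis (Fin m) ℝ E) (A : Set E) :
    (fun z : Fin m → ℤ => β.equivFun.symm fun k => (z k : ℝ)) ''
      intPoints (β.equivFun.symm ⁻¹' A) = (Submodule.span ℤ (Set.range β) : Set E) ∩ A := by
  ext x
  simp only [Set.mem_inter_iff, SetLike.mem_coe, β.mem_span_iff_repr_mem ℤ]
  constructor
  · rintro ⟨z, hz, rfl⟩
    exact ⟨fun i => ⟨z i, (β.coord_equivFun_symm i fun k => (z k : ℝ)).symm⟩, hz⟩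
  · rintro ⟨hx, hxA⟩
    choose z hz using hx
    have hzx : β.equivFun.symm (fun k => (z k : ℝ)) = x :=
      β.equivFun.symm_apply_eq.2 (funext hz)
    exact ⟨z, by simpa only [intPoints, Set.mem_ofPred_eq, Set.mem_preimage, hzx], hzx⟩

theorem ncard_span_inter (β : Basis (Fin m) ℝ E) (A : Set E) :
    ((Submodule.span ℤ (Set.range β) : Set E) ∩ A).ncard =
      (intPoints (β.equivFun.symm ⁻¹' A)).ncard := by
  rw [← image_intPoints_preimage, Set.ncard_image_of_injective]
  exact β.equivFun.symm.injective.comp fun z w h =>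
    funext fun k => Int.cast_injective (congrFun h k)

theorem ncard_span_inter_coord_zero_eq (β : Basis (Fin (m + 1)) ℝ E) (A : Set E) (n : ℤ) :
    ((Submodule.span ℤ (Set.range β) : Set E) ∩ A ∩ {x | β.coord 0 x = n}).ncard =
      (intPoints (headSlice (β.equivFun.symm ⁻¹' A) n)).ncard := by
  rw [Set.inter_assoc, ncard_span_inter, ncard_intPoints_headSlice]
  congr 1
  ext z
  simp only [intPoints, Set.mem_ofPred_eq, Set.preimage_inter, Set.mem_inter_iff,
    Set.mem_preimage, Basis.coord_equivFun_symm, Int.cast_inj]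

theorem volumeReal_headSlice_eq_of_span_eq {β β' : Basis (Fin (m + 1)) ℝ E}
    (hspan : Submodule.span ℤ (Set.range β) = Submodule.span ℤ (Set.range β'))
    {u : E ≃ₗ[ℝ] E} (hdet : |LinearMap.det (u : E →ₗ[ℝ] E)| = 1)
    (hcoord : ∀ x, β'.coord 0 (u x) = β.coord 0 x) {A : Set E} (hA : u • A = A) (t : ℝ) :
    volume.real (headSlice (β.equivFun.symm ⁻¹' A) t) =
      volume.real (headSlice (β'.equivFun.symm ⁻¹' A) t) := by
  let S : (Fin (m + 1) → ℝ) →ₗ[ℝ] Fin (m + 1) → ℝ :=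
    β'.equivFun ∘ₗ (u : E →ₗ[ℝ] E) ∘ₗ β.equivFun.symm
  have hS0 : ∀ v, S v 0 = v 0 := fun v =>
    (hcoord (β.equivFun.symm v)).trans (β.coord_equivFun_symm 0 v)
  have hS : S = Matrix.toLin' (β'.toMatrix β) ∘ₗ
      (β.equivFun ∘ₗ (u : E →ₗ[ℝ] E) ∘ₗ β.equivFun.symm) := by
    refine LinearMap.ext fun v => ?_
    simp [S, Matrix.toLin'_apply, Basis.toMatrix_mulVec_repr, Basis.equivFun]
  have hSdet : |S.det| = 1 := by
    rw [hS, LinearMap.det_comp, LinearMap.det_toLin', ← Basis.det_apply,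
      LinearMap.det_conj, abs_mul, hdet, abs_det_eq_one_of_span_eq hspan, mul_one]
  have hpre : S ⁻¹' (β'.equivFun.symm ⁻¹' A) = β.equivFun.symm ⁻¹' A := by
    ext v
    simp only [S, Set.mem_preimage, LinearMap.comp_apply, LinearEquiv.coe_coe,
      LinearEquiv.symm_apply_apply]
    nth_rw 1 [← hA]
    exact Set.smul_mem_smul_set_iff (a := u)
  rw [← hpre, volumeReal_headSlice_preimage hSdet hS0]

end Basis

section FiniteDimensional

variable [FiniteDimensional ℝ E]

theorem abs_det_eq_one_of_smul_eq {W : Set E} (hb : Bornology.IsBounded W) (h0 : W ∈ 𝓝 0)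
    {u : E ≃ₗ[ℝ] E} (hu : u • W = W) : |LinearMap.det (u : E →ₗ[ℝ] E)| = 1 := by
  borelize E
  have h : Measure.addHaar W = _ := congrArg Measure.addHaar hu.symm
  have himage : u • W = (u : E →ₗ[ℝ] E) '' W := rfl
  rw [himage, Measure.addHaar_image_linearMap] at h
  have hpos : Measure.addHaar W ≠ 0 := (Measure.measure_pos_of_mem_nhds _ h0).ne'
  have hone := (ENNReal.mul_eq_right hpos hb.measure_lt_top.ne).1 h.symm
  rwa [ENNReal.ofReal_eq_one] at hone

theorem finite_inter_of_isBounded (Γ : Submodule ℤ E) [DiscreteTopology Γ] {A : Set E}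
    (hA : Bornology.IsBounded A) : ((Γ : Set E) ∩ A).Finite := by
  have : DiscreteTopology Γ.toAddSubgroup := inferInstanceAs (DiscreteTopology Γ)
  rw [Set.inter_comm]
  exact Metric.finite_isBounded_inter_isClosed DiscreteTopology.isDiscrete hA
    (AddSubgroup.isClosed_of_discrete (H := Γ.toAddSubgroup))

end FiniteDimensional

end ZLattice

section Coordinates

variable {E : Type*} [NormedAddCommGroup E] [NormedSpace ℝ E] {m : ℕ}

theorem exists_forall_equivFun_symm_preimage_smul_subset_closedBall (β : Basis (Fin m) ℝ E)
    {W : Set E} (hb : Bornology.IsBounded W) :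
    ∃ R : ℝ, 0 ≤ R ∧ ∀ D : ℝ, 0 ≤ D → β.equivFun.symm ⁻¹' (D • W) ⊆ closedBall 0 (D * R) := by
  have hbim := (NormedSpace.isVonNBounded_iff ℝ).1
    (((NormedSpace.isVonNBounded_iff ℝ).2 hb).image β.equivFunL.toContinuousLinearMap)
  obtain ⟨R, hR, hWR⟩ := hbim.exists_pos_norm_le
  refine ⟨R, hR.le, fun D hD v hv => ?_⟩
  obtain ⟨w, hw, hwv⟩ := hv
  have hwv' : v = D • β.equivFun w := by
    rw [← map_smul]
    exact (β.equivFun.symm_apply_eq.1 hwv.symm)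
  rw [mem_closedBall_zero_iff, hwv', norm_smul, Real.norm_of_nonneg hD]
  exact mul_le_mul_of_nonneg_left (hWR _ ⟨w, hw, rfl⟩) hD

theorem exists_forall_abs_ncard_sub_volumeReal_headSlice_le (β : Basis (Fin (m + 1)) ℝ E)
    {W : Set E} (hc : Convex ℝ W) (hb : Bornology.IsBounded W) :
    ∃ C : ℝ, 0 ≤ C ∧ ∀ D : ℝ, 1 ≤ D → ∀ n : ℤ,
      |(((Submodule.span ℤ (Set.range β) : Set E) ∩ D • W ∩ {x | β.coord 0 x = n}).ncard : ℝ) -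
        volume.real (headSlice (β.equivFun.symm ⁻¹' (D • W)) n)| ≤
          C * (D ^ (m + 1) / D ^ 2) := by
  obtain ⟨R, hR, hsub⟩ := exists_forall_equivFun_symm_preimage_smul_subset_closedBall β hb
  refine ⟨m * (2 * R + 1) ^ (m - 1), by positivity, fun D hD n => ?_⟩
  have hD0 : 0 < D := one_pos.trans_le hD
  have hcD : Convex ℝ (β.equivFun.symm ⁻¹' (D • W)) :=
    (hc.smul D).linear_preimage β.equivFun.symm.toLinearMap
  rw [ncard_span_inter_coord_zero_eq]
  refine (abs_ncard_intPoints_sub_volume_le_mul_pow hR hD (convex_headSlice hcD n)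
    (headSlice_subset_closedBall (by positivity) (hsub D hD0.le) n)).trans_eq ?_
  rcases m with _ | k
  · simp
  · rw [add_assoc k 1 1, pow_add D k 2, mul_div_cancel_right₀ _ (pow_pos hD0 2).ne',
      Nat.add_sub_cancel]

end Coordinates

section ZLattice

variable {E : Type*} [NormedAddCommGroup E] [NormedSpace ℝ E] [FiniteDimensional ℝ E]
  {Γ : Submodule ℤ E} [DiscreteTopology Γ] [IsZLattice ℝ Γ]

theorem exists_basis_span_eq_and_apply_eq_coord_zero_mul {m : ℕ} (hm : finrank ℝ E = m + 1)
    {ℓ : Dual ℝ E} {g : ℝ} (hg : g ≠ 0)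
    (hℓ : Γ.map (ℓ.restrictScalars ℤ) = Submodule.span ℤ {g}) :
    ∃ β : Basis (Fin (m + 1)) ℝ E, Submodule.span ℤ (Set.range β) = Γ ∧
      ∀ x, ℓ x = β.coord 0 x * g := by
  have := ZLattice.module_free ℝ Γ
  have := ZLattice.module_finite ℝ Γ
  let e := LinearEquiv.toSpanNonzeroSingleton ℤ ℝ g hg
  let f : Γ →ₗ[ℤ] ℤ :=
    (e.symm ∘ₗ (LinearEquiv.ofEq _ _ hℓ).toLinearMap) ∘ₗ (ℓ.restrictScalars ℤ).submoduleMap Γ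
  have hf : Function.Surjective f := by
    rw [LinearMap.coe_comp]
    exact ((LinearEquiv.ofEq _ _ hℓ).trans e.symm).surjective.comp
      ((ℓ.restrictScalars ℤ).submoduleMap_surjective Γ)
  have hfg : ∀ x : Γ, (f x : ℝ) * g = ℓ x := fun x => by
    have h := congrArg Subtype.val
      (e.apply_symm_apply (LinearEquiv.ofEq _ _ hℓ ((ℓ.restrictScalars ℤ).submoduleMap Γ x)))
    rw [← zsmul_eq_mul]
    exact h
  obtain ⟨b, hb⟩ := exists_basis_coord_zero_eq ((ZLattice.rank ℝ Γ).trans hm) hf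
  let β := b.ofZLatticeBasis ℝ Γ
  refine ⟨β, b.ofZLatticeBasis_span ℝ, fun x => ?_⟩
  have hlin : ℓ = g • β.coord 0 := β.ext fun i => by
    rw [b.ofZLatticeBasis_apply ℝ, ← hfg, ← hb, mul_comm]
    exact congrArg (g * ·) (b.ofZLatticeBasis_repr_apply ℝ Γ (b i) 0).symm
  rw [hlin, LinearMap.smul_apply, smul_eq_mul, mul_comm]

theorem exists_forall_abs_sub_ncard_inter_fiber_le_of_map_eq_span {W : Set E} (hc : Convex ℝ W)
    (hb : Bornology.IsBounded W) (h0 : W ∈ 𝓝 0) {u : E ≃ₗ[ℝ] E} (hu : u • W = W)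
    {ℓ ℓ' : Dual ℝ E} (hℓu : ∀ x, ℓ' (u x) = ℓ x) {g : ℝ} (hg : g ≠ 0)
    (hℓ : Γ.map (ℓ.restrictScalars ℤ) = Submodule.span ℤ {g})
    (hℓ' : Γ.map (ℓ'.restrictScalars ℤ) = Submodule.span ℤ {g}) :
    ∃ C : ℝ, 0 ≤ C ∧ ∀ D : ℝ, 1 ≤ D → ∀ y : ℝ,
      |(((Γ : Set E) ∩ D • W ∩ {x | ℓ x = y}).ncard : ℝ) -
        ((Γ : Set E) ∩ D • W ∩ {x | ℓ' x = y}).ncard| ≤ C * (D ^ finrank ℝ E / D ^ 2) := by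
  have : Nontrivial E := by
    obtain ⟨x, -, hx⟩ : g ∈ Γ.map (ℓ.restrictScalars ℤ) :=
      hℓ ▸ Submodule.mem_span_singleton_self g
    exact nontrivial_of_ne x 0 fun h => hg (by rw [← hx, h, map_zero])
  obtain ⟨m, hm⟩ := Nat.exists_eq_add_one.2 (finrank_pos (R := ℝ) (M := E))
  obtain ⟨β, hspan, hβ⟩ := exists_basis_span_eq_and_apply_eq_coord_zero_mul hm hg hℓ
  obtain ⟨β', hspan', hβ'⟩ := exists_basis_span_eq_and_apply_eq_coord_zero_mul hm hg hℓ'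
  obtain ⟨C, hC0, hC⟩ := exists_forall_abs_ncard_sub_volumeReal_headSlice_le β hc hb
  obtain ⟨C', hC0', hC'⟩ := exists_forall_abs_ncard_sub_volumeReal_headSlice_le β' hc hb
  rw [hspan] at hC
  rw [hspan'] at hC'
  rw [hm]
  have hdet := abs_det_eq_one_of_smul_eq hb h0 hu
  have hcoord : ∀ x, β'.coord 0 (u x) = β.coord 0 x := fun x => by
    apply mul_right_cancel₀ hg
    rw [← hβ', ← hβ, hℓu]
  refine ⟨C + C', add_nonneg hC0 hC0', fun D hD y => ?_⟩
  by_cases hy : y ∈ Submodule.span ℤ {g}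
  · obtain ⟨n, rfl⟩ := Submodule.mem_span_singleton.1 hy
    have hDW : u • D • W = D • W := by rw [smul_comm, hu]
    have hvol := volumeReal_headSlice_eq_of_span_eq (hspan.trans hspan'.symm) hdet hcoord hDW n
    have hlevel : ∀ b : ℝ, b * g = n • g ↔ b = n := fun b => by
      rw [zsmul_eq_mul, mul_left_inj' hg]
    have hCn := hC D hD n
    rw [hvol] at hCn
    have hCn' := hC' D hD n
    rw [abs_sub_comm] at hCn'
    simp only [hβ, hβ', hlevel, add_mul]
    exact (abs_sub_le _ _ _).trans (add_le_add hCn hCn')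
  · have hempty : ∀ φ : Dual ℝ E, Γ.map (φ.restrictScalars ℤ) = Submodule.span ℤ {g} →
        (Γ : Set E) ∩ D • W ∩ {x | φ x = y} = ∅ := fun φ hφ =>
      Set.eq_empty_of_forall_notMem fun x hx => hy (hφ ▸ ⟨x, hx.1.1, hx.2⟩)
    rw [hempty ℓ hℓ, hempty ℓ' hℓ', sub_self, abs_zero]
    positivity

theorem exists_forall_abs_sub_ncard_inter_fiber_le {W : Set E} (hc : Convex ℝ W)
    (hb : Bornology.IsBounded W) (h0 : W ∈ 𝓝 0) {u : E ≃ₗ[ℝ] E} (hu : u • W = W)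
    {ℓ ℓ' : Dual ℝ E} (hℓu : ∀ x, ℓ' (u x) = ℓ x)
    (hℓ : (Γ.map (ℓ.restrictScalars ℤ)).IsPrincipal)
    (hℓ' : Γ.map (ℓ'.restrictScalars ℤ) = Γ.map (ℓ.restrictScalars ℤ)) :
    ∃ C : ℝ, 0 ≤ C ∧ ∀ D : ℝ, 1 ≤ D → ∀ y : ℝ,
      |(((Γ : Set E) ∩ D • W ∩ {x | ℓ x = y}).ncard : ℝ) -
        ((Γ : Set E) ∩ D • W ∩ {x | ℓ' x = y}).ncard| ≤ C * (D ^ finrank ℝ E / D ^ 2) := by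
  obtain ⟨g, hg⟩ := hℓ
  rw [hg] at hℓ'
  rcases eq_or_ne g 0 with rfl | hg0
  · have hzero : ∀ φ : Dual ℝ E, Γ.map (φ.restrictScalars ℤ) = Submodule.span ℤ {0} →
        ∀ x ∈ Γ, φ x = 0 := fun φ hφ x hx => by
      rw [Submodule.span_zero_singleton] at hφ
      exact (Submodule.mem_bot ℤ).1 (hφ ▸ Submodule.mem_map_of_mem hx)
    refine ⟨0, le_rfl, fun D _ y => ?_⟩
    have hfiber : (Γ : Set E) ∩ D • W ∩ {x | ℓ x = y} = (Γ : Set E) ∩ D • W ∩ {x | ℓ' x = y} :=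
      Set.ext fun x => and_congr_right fun hx => by
        rw [Set.mem_ofPred_eq, Set.mem_ofPred_eq, hzero ℓ hg x hx.1, hzero ℓ' hℓ' x hx.1]
    rw [hfiber, sub_self, abs_zero, zero_mul]
  · exact exists_forall_abs_sub_ncard_inter_fiber_le_of_map_eq_span hc hb h0 hu hℓu hg0 hg hℓ'

theorem exists_forall_mul_pow_le_ncard_inter {W : Set E} (hb : Bornology.IsBounded W)
    (h0 : W ∈ 𝓝 0) :
    ∃ c > 0, ∀ D : ℝ, 0 < D → c * D ^ finrank ℝ E ≤ ((Γ : Set E) ∩ D • W).ncard := by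
  have := ZLattice.module_free ℝ Γ
  have := ZLattice.module_finite ℝ Γ
  let b := (finBasisOfFinrankEq ℤ Γ (ZLattice.rank ℝ Γ)).ofZLatticeBasis ℝ Γ
  have hspan : Submodule.span ℤ (Set.range b) = Γ := Basis.ofZLatticeBasis_span ℝ Γ _
  have hpre : b.equivFun.symm ⁻¹' W ∈ 𝓝 0 :=
    b.equivFunL.symm.continuous.continuousAt.preimage_mem_nhds (by simpa using h0)
  obtain ⟨s, hs, hsW⟩ := nhds_basis_closedBall.mem_iff.1 hpre
  obtain ⟨R, -, hR⟩ := exists_forall_equivFun_symm_preimage_smul_subset_closedBall b hb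
  refine ⟨s ^ finrank ℝ E, by positivity, fun D hD => ?_⟩
  have hball : closedBall 0 (D * s) ⊆ b.equivFun.symm ⁻¹' (D • W) := by
    have h := Set.smul_set_mono (a := D) hsW
    rw [_root_.smul_closedBall _ _ hs.le, smul_zero, Real.norm_of_nonneg hD.le] at h
    rintro v hv
    obtain ⟨w, hw, rfl⟩ := h hv
    exact ⟨_, hw, (map_smul b.equivFun.symm D w).symm⟩
  have hcount := pow_le_ncard_intPoints (by positivity)
    (isBounded_closedBall.subset (hR D hD.le)) hball
  rwa [← ncard_span_inter, hspan, mul_pow, mul_comm] at hcount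

end ZLattice

/-! ### The lattice cut out by local conditions -/

/-- `coordEmb` as a `ℚ`-linear map. -/
def coordEmbLinear (K : Type*) [Field K] [Algebra ℚ K] (r : ℕ) :
    (Fin r → ℚ) →ₗ[ℚ] (Fin r → K) :=
  (Algebra.linearMap ℚ K).compLeft (Fin r)

section CoordEmb

variable {K : Type*} [Field K] [Algebra ℚ K] {r : ℕ}

@[simp]
theorem coordEmbLinear_apply (x : Fin r → ℚ) : coordEmbLinear K r x = coordEmb K x :=
  rfl

theorem coordEmb_smul (a : ℚ) (x : Fin r → ℚ) :
    coordEmb K (a • x) = algebraMap ℚ K a • coordEmb K x := by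
  rw [← coordEmbLinear_apply, map_smul, algebraMap_smul, coordEmbLinear_apply]

theorem coordEmb_injective : Function.Injective (coordEmb K : (Fin r → ℚ) → Fin r → K) :=
  fun _ _ h => funext fun k => (algebraMap ℚ K).injective (congrFun h k)

theorem span_image_coordEmb_eq_top {S : Set (Fin r → ℚ)} (hS : Submodule.span ℚ S = ⊤) :
    Submodule.span K (coordEmb K '' S) = ⊤ := by
  have hle : (⊤ : Submodule ℚ (Fin r → ℚ)).map (coordEmbLinear K r) ≤
      (Submodule.span K (coordEmb K '' S)).restrictScalars ℚ := by
    rw [← hS, Submodule.map_span_le]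
    exact fun x hx => Submodule.subset_span ⟨x, hx, rfl⟩
  rw [eq_top_iff, ← (Pi.basisFun K (Fin r)).span_eq, Submodule.span_le]
  rintro _ ⟨i, rfl⟩
  refine hle ⟨Pi.single i 1, trivial, ?_⟩
  rw [Pi.basisFun_apply]
  refine funext fun k => ?_
  rw [coordEmbLinear_apply, coordEmb,
    Pi.apply_single (fun _ => algebraMap ℚ K) (fun _ => map_zero _), map_one]

end CoordEmb

section RealLattice

variable {r : ℕ} (Λ : Submodule ℤ (Fin r → ℚ))

/-- The image in `ℝ^r` of a `ℤ`-submodule of `ℚ^r`. -/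
noncomputable def realLattice : Submodule ℤ (Fin r → ℝ) :=
  Λ.map ((coordEmbLinear ℝ r).restrictScalars ℤ)

theorem coe_realLattice : (realLattice Λ : Set (Fin r → ℝ)) = coordEmb ℝ '' Λ :=
  rfl

theorem exists_basis_span_eq_realLattice [hΛ : Submodule.IsLattice ℚ Λ] :
    ∃ β : Basis (Fin r) ℝ (Fin r → ℝ), Submodule.span ℤ (Set.range β) = realLattice Λ := by
  have := Submodule.IsLattice.free ℚ Λ
  have := Submodule.IsLattice.finite ℚ Λ
  have hrank : finrank ℤ Λ = r := by
    rw [Submodule.IsLattice.finrank_of_pi ℚ Λ, Fintype.card_fin]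
  let b := finBasisOfFinrankEq ℤ Λ hrank
  have hb : Submodule.span ℤ (Set.range fun i => (b i : Fin r → ℚ)) = Λ := by
    have h := congrArg (Submodule.map Λ.subtype) b.span_eq
    rwa [Submodule.map_span, Submodule.map_top, Submodule.range_subtype, ← Set.range_comp] at h
  have hspan : Submodule.span ℤ (Set.range fun i => coordEmb ℝ (b i : Fin r → ℚ)) =
      realLattice Λ := by
    have h := Submodule.map_span ((coordEmbLinear ℝ r).restrictScalars ℤ)
      (Set.range fun i => (b i : Fin r → ℚ))
    rw [hb, ← Set.range_comp] at h
    exact h.symm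
  have htop : ⊤ ≤ Submodule.span ℝ (Set.range fun i => coordEmb ℝ (b i : Fin r → ℚ)) := by
    rw [← Submodule.span_span_of_tower ℤ, hspan, coe_realLattice,
      span_image_coordEmb_eq_top hΛ.span_eq_top]
  refine ⟨basisOfTopLeSpanOfCardEqFinrank _ htop (by simp), ?_⟩
  rw [coe_basisOfTopLeSpanOfCardEqFinrank, hspan]

instance [Submodule.IsLattice ℚ Λ] : DiscreteTopology (realLattice Λ) := by
  obtain ⟨β, hβ⟩ := exists_basis_span_eq_realLattice Λ
  rw [← hβ]
  infer_instance

instance [Submodule.IsLattice ℚ Λ] : IsZLattice ℝ (realLattice Λ) := by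
  obtain ⟨β, hβ⟩ := exists_basis_span_eq_realLattice Λ
  constructor
  rw [← hβ]
  exact IsZLattice.span_top

theorem ncard_realLattice_inter (A : Set (Fin r → ℝ)) :
    ((realLattice Λ : Set (Fin r → ℝ)) ∩ A).ncard =
      ((Λ : Set (Fin r → ℚ)) ∩ coordEmb ℝ ⁻¹' A).ncard := by
  rw [coe_realLattice, ← Set.image_inter_preimage,
    Set.ncard_image_of_injective _ coordEmb_injective]

theorem map_formOver_realLattice (L : Dual ℚ (Fin r → ℚ)) :
    (realLattice Λ).map ((formOver ℝ L).restrictScalars ℤ) =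
      (Λ.map (L.restrictScalars ℤ)).map ((Algebra.linearMap ℚ ℝ).restrictScalars ℤ) := by
  rw [realLattice, ← Submodule.map_comp, ← Submodule.map_comp]
  congr 1
  exact LinearMap.ext fun x => formOver_coordEmb ℝ L x

end RealLattice

theorem isPrincipal_of_fg {R K : Type*} [CommRing R] [IsDomain R] [IsPrincipalIdealRing R]
    [Field K] [Algebra R K] [IsFractionRing R K] {A : Submodule R K} (hA : A.FG) :
    A.IsPrincipal :=
  FractionalIdeal.isPrincipal
    (⟨A, FractionalIdeal.isFractional_of_fg hA⟩ : FractionalIdeal (nonZeroDivisors R) K)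

theorem isPrincipal_map_formOver_realLattice {r : ℕ} {Λ : Submodule ℤ (Fin r → ℚ)} (hΛ : Λ.FG)
    (L : Dual ℚ (Fin r → ℚ)) :
    ((realLattice Λ).map ((formOver ℝ L).restrictScalars ℤ)).IsPrincipal := by
  have := isPrincipal_of_fg (hΛ.map (L.restrictScalars ℤ))
  rw [map_formOver_realLattice]
  exact this.map _

section FractionRing

variable {R K V : Type*} [CommRing R] [IsDomain R] [Field K] [Algebra R K] [IsFractionRing R K]
  [AddCommGroup V] [Module R V] [Module K V] [IsScalarTower R K V] {M N : Submodule R V}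

theorem exists_ne_zero_smul_mem_of_span_eq_top (hM : Submodule.span K (M : Set V) = ⊤) (x : V) :
    ∃ a : R, a ≠ 0 ∧ a • x ∈ M := by
  obtain ⟨a, ha⟩ := multiple_mem_span_of_mem_localization_span (nonZeroDivisors R) K (M : Set V) x
    (hM ▸ Submodule.mem_top)
  rw [Submodule.span_eq] at ha
  exact ⟨a, nonZeroDivisors.coe_ne_zero a, ha⟩

theorem exists_ne_zero_forall_smul_mem_of_fg (hM : Submodule.span K (M : Set V) = ⊤)
    (hN : N.FG) : ∃ a : R, a ≠ 0 ∧ ∀ x ∈ N, a • x ∈ M := by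
  induction N, hN using Submodule.fg_induction with
  | singleton x =>
    obtain ⟨a, ha, hax⟩ := exists_ne_zero_smul_mem_of_span_eq_top hM x
    refine ⟨a, ha, fun y hy => ?_⟩
    obtain ⟨c, rfl⟩ := Submodule.mem_span_singleton.1 hy
    rw [smul_comm]
    exact M.smul_mem c hax
  | sup N₁ N₂ _ _ h₁ h₂ =>
    obtain ⟨a₁, ha₁, h₁⟩ := h₁
    obtain ⟨a₂, ha₂, h₂⟩ := h₂
    refine ⟨a₁ * a₂, mul_ne_zero ha₁ ha₂, fun y hy => ?_⟩
    obtain ⟨y₁, hy₁, y₂, hy₂, rfl⟩ := Submodule.mem_sup.1 hy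
    rw [smul_add]
    refine M.add_mem ?_ ?_
    · rw [mul_comm, mul_smul]
      exact M.smul_mem a₂ (h₁ y₁ hy₁)
    · rw [mul_smul]
      exact M.smul_mem a₁ (h₂ y₂ hy₂)

theorem isLattice_of_forall_smul_mem [IsNoetherianRing R] [hN : Submodule.IsLattice K N] {a b : R}
    (ha : a ≠ 0) (hb : b ≠ 0) (hMN : ∀ x ∈ M, a • x ∈ N) (hNM : ∀ x ∈ N, b • x ∈ M) :
    Submodule.IsLattice K M where
  fg := by
    have : Module.IsTorsionFree R V := Module.IsTorsionFree.trans_faithfulSMul R K V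
    have : Module.Finite R N := Module.Finite.iff_fg.2 hN.fg
    refine Submodule.fg_of_fg_map_injective (LinearMap.lsmul R V a)
      (smul_right_injective V ha) (Submodule.FG.of_le hN.fg ?_)
    rintro _ ⟨x, hx, rfl⟩
    exact hMN x hx
  span_eq_top := by
    rw [eq_top_iff, ← hN.span_eq_top, Submodule.span_le]
    intro x hx
    have hb' : algebraMap R K b ≠ 0 := (map_ne_zero_iff _ (IsFractionRing.injective R K)).2 hb
    refine ((Submodule.span K (M : Set V)).smul_mem_iff hb').1 ?_
    rw [algebraMap_smul]
    exact Submodule.subset_span (hNM x hx)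

end FractionRing

theorem exists_forall_pow_nsmul_mem_of_fg {p : ℕ} [hp : Fact p.Prime] {V : Type*} [AddCommGroup V]
    [Module ℤ_[p] V] [Module ℚ_[p] V] [IsScalarTower ℤ_[p] ℚ_[p] V] {M N : Submodule ℤ_[p] V}
    (hM : Submodule.span ℚ_[p] (M : Set V) = ⊤) (hN : N.FG) :
    ∃ k : ℕ, ∀ x ∈ N, p ^ k • x ∈ M := by
  obtain ⟨a, ha, h⟩ := exists_ne_zero_forall_smul_mem_of_fg hM hN
  refine ⟨a.valuation, fun x hx => ?_⟩
  have hax := h x hx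
  rwa [PadicInt.unitCoeff_spec ha, mul_smul, M.smul_mem_iff_of_isUnit (Units.isUnit _),
    ← Nat.cast_pow, Nat.cast_smul_eq_nsmul] at hax

theorem exists_ne_zero_forall_nsmul_mem {r : ℕ}
    {Ω Ω' : ∀ (p : ℕ) [Fact p.Prime], Submodule ℤ_[p] (Fin r → ℚ_[p])}
    (hΩ : ∀ (p : ℕ) [Fact p.Prime], (Ω p).FG)
    (hΩ' : ∀ (p : ℕ) [Fact p.Prime], Submodule.span ℚ_[p] (Ω' p : Set (Fin r → ℚ_[p])) = ⊤)
    (hfin : {p : ℕ | ∃ _ : Fact p.Prime, Ω p ≠ Ω' p}.Finite) :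
    ∃ N : ℕ, N ≠ 0 ∧ ∀ (p : ℕ) [Fact p.Prime], ∀ x ∈ Ω p, N • x ∈ Ω' p := by
  have hpow : ∀ p : ℕ, ∃ k : ℕ, ∀ _ : Fact p.Prime, ∀ x ∈ Ω p, p ^ k • x ∈ Ω' p := fun p => by
    by_cases hp : p.Prime
    · have : Fact p.Prime := ⟨hp⟩
      exact (exists_forall_pow_nsmul_mem_of_fg (hΩ' p) (hΩ p)).imp fun _ hk _ => hk
    · exact ⟨0, fun h => absurd h.out hp⟩
  choose k hk using hpow
  refine ⟨∏ q ∈ hfin.toFinset, q ^ k q, Finset.prod_ne_zero_iff.2 fun q hq => ?_,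
    fun p hp x hx => ?_⟩
  · obtain ⟨hq, -⟩ := hfin.mem_toFinset.1 hq
    exact pow_ne_zero _ hq.out.ne_zero
  · by_cases heq : Ω p = Ω' p
    · exact (Ω' p).nsmul_mem (heq ▸ hx) _
    · obtain ⟨c, hc⟩ := Finset.dvd_prod_of_mem (fun q => q ^ k q) (hfin.mem_toFinset.2 ⟨hp, heq⟩)
      rw [hc, mul_comm, mul_smul]
      exact (Ω' p).nsmul_mem (hk p hp x hx) c

section StandardLattice

variable {r : ℕ}

theorem mem_standardLattice {p : ℕ} [Fact p.Prime] {x : Fin r → ℚ_[p]} :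
    x ∈ standardLattice p r ↔ ∀ i, ‖x i‖ ≤ 1 := by
  simp only [standardLattice, Submodule.mem_pi, Set.mem_univ, forall_true_left, Submodule.mem_one]
  refine forall_congr' fun i => ⟨?_, fun h => ⟨⟨x i, h⟩, rfl⟩⟩
  rintro ⟨a, ha⟩
  rw [← ha]
  exact a.norm_le_one

instance (p : ℕ) [Fact p.Prime] : Submodule.IsLattice ℚ_[p] (standardLattice p r) where
  fg := Submodule.fg_pi fun _ => Submodule.one_eq_span (R := ℤ_[p]) (A := ℚ_[p]) ▸
    Submodule.fg_span_singleton _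
  span_eq_top := by
    rw [eq_top_iff, ← (Pi.basisFun ℚ_[p] (Fin r)).span_eq]
    refine Submodule.span_mono ?_
    rintro _ ⟨i, rfl⟩
    refine mem_standardLattice.2 fun j => ?_
    rw [Pi.basisFun_apply, Pi.single_apply]
    split_ifs <;> simp

theorem den_eq_one_of_forall_padic_norm_le_one {q : ℚ}
    (h : ∀ (p : ℕ) [Fact p.Prime], ‖(q : ℚ_[p])‖ ≤ 1) : q.den = 1 := by
  rw [Nat.eq_one_iff_not_exists_prime_dvd]
  intro p hp hdvd
  have : Fact p.Prime := ⟨hp⟩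
  have hunit := PadicInt.isUnit_iff.1 (PadicInt.isUnit_den q (h p))
  rw [PadicInt.norm_natCast_eq_one_iff] at hunit
  exact (hp.coprime_iff_not_dvd.1 hunit) hdvd

theorem toIntSubmodule_globalLattice_standardLattice :
    (globalLattice fun p _ => standardLattice p r).toIntSubmodule =
      Submodule.span ℤ (Set.range (Pi.basisFun ℚ (Fin r))) := by
  ext x
  rw [(Pi.basisFun ℚ (Fin r)).mem_span_iff_repr_mem ℤ]
  constructor
  · intro hx i
    have hden : (x i).den = 1 :=
      den_eq_one_of_forall_padic_norm_le_one fun p _ => mem_standardLattice.1 (hx p) i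
    exact ⟨(x i).num, (Rat.den_eq_one_iff _).1 hden⟩
  · intro hx p _
    refine mem_standardLattice.2 fun i => ?_
    obtain ⟨z, hz⟩ := hx i
    have hz' : coordEmb ℚ_[p] x i = (z : ℚ_[p]) := by
      rw [coordEmb, ← Pi.basisFun_repr ℚ (Fin r) x i, ← hz]
      simp
    rw [hz']
    exact Padic.norm_int_le_one z

end StandardLattice

section GlobalLattice

variable {r : ℕ} {Ω Ω' : ∀ (p : ℕ) [Fact p.Prime], Submodule ℤ_[p] (Fin r → ℚ_[p])}

theorem exists_ne_zero_forall_nsmul_mem_globalLattice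
    (hΩ : ∀ (p : ℕ) [Fact p.Prime], (Ω p).FG)
    (hΩ' : ∀ (p : ℕ) [Fact p.Prime], Submodule.span ℚ_[p] (Ω' p : Set (Fin r → ℚ_[p])) = ⊤)
    (hfin : {p : ℕ | ∃ _ : Fact p.Prime, Ω p ≠ Ω' p}.Finite) :
    ∃ N : ℕ, N ≠ 0 ∧ ∀ x ∈ globalLattice Ω, N • x ∈ globalLattice Ω' := by
  obtain ⟨N, hN, h⟩ := exists_ne_zero_forall_nsmul_mem hΩ hΩ' hfin
  refine ⟨N, hN, fun x hx p _ => ?_⟩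
  rw [← coordEmbLinear_apply, map_nsmul, coordEmbLinear_apply]
  exact h p _ (hx p)

theorem isLattice_globalLattice
    (hΩ : ∀ (p : ℕ) [Fact p.Prime], Submodule.IsLattice ℚ_[p] (Ω p))
    (hfin : {p : ℕ | ∃ _ : Fact p.Prime, Ω p ≠ standardLattice p r}.Finite) :
    Submodule.IsLattice ℚ (globalLattice Ω).toIntSubmodule := by
  obtain ⟨a, ha, hΩstd⟩ := exists_ne_zero_forall_nsmul_mem_globalLattice
    (Ω' := fun p _ => standardLattice p r) (fun p _ => (hΩ p).fg)
    (fun p _ => Submodule.IsLattice.span_eq_top) hfin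
  obtain ⟨b, hb, hstdΩ⟩ := exists_ne_zero_forall_nsmul_mem_globalLattice
    (Ω := fun p _ => standardLattice p r) (fun p _ => Submodule.IsLattice.fg)
    (fun p _ => (hΩ p).span_eq_top) (by simpa only [ne_comm] using hfin)
  have hstd : Submodule.IsLattice ℚ
      (globalLattice fun p _ => standardLattice p r).toIntSubmodule := by
    rw [toIntSubmodule_globalLattice_standardLattice]
    exact ⟨Submodule.fg_span (Set.finite_range _), by
      rw [Submodule.span_span_of_tower, Basis.span_eq]⟩
  refine isLattice_of_forall_smul_mem (hN := hstd) (a := (a : ℤ)) (b := b)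
    (Nat.cast_ne_zero.2 ha) (Nat.cast_ne_zero.2 hb) (fun x hx => ?_) fun x hx => ?_
  · rw [Nat.cast_smul_eq_nsmul]
    exact hΩstd x hx
  · rw [Nat.cast_smul_eq_nsmul]
    exact hstdΩ x hx

end GlobalLattice

/-! ### Rational points in orbits of linear forms -/

section Orbit

variable {K : Type*} [Field K] {r n : ℕ} {W : Set (Fin r → K)}
  {ℓ : Fin n → Dual K (Fin r → K)}

theorem InSingleOrbit.exists_smul_eq_and_forall_apply_eq (h : InSingleOrbit W ℓ) (i j : Fin n) :
    ∃ u : (Fin r → K) ≃ₗ[K] (Fin r → K), u • W = W ∧ ∀ x, ℓ j (u x) = ℓ i x := by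
  obtain ⟨u, hu, hij⟩ := h i j
  refine ⟨u, hu, fun x => ?_⟩
  rw [hij]
  exact congrArg (ℓ i) (u.symm_apply_apply x)

theorem InSingleOrbit.exists_mem_apply_eq (h : InSingleOrbit W ℓ) (i j : Fin n) {x : Fin r → K}
    (hx : x ∈ W) : ∃ w ∈ W, ℓ j w = ℓ i x := by
  obtain ⟨u, hu, hℓ⟩ := h.exists_smul_eq_and_forall_apply_eq i j
  exact ⟨u x, hu ▸ Set.smul_mem_smul_set hx, hℓ x⟩

theorem InSingleOrbit.eq_zero_of_eq_zero [Algebra ℚ K] {L : Fin n → Dual ℚ (Fin r → ℚ)}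
    (h : InSingleOrbit W fun i => formOver K (L i)) {i j : Fin n} (hj : L j = 0) : L i = 0 := by
  obtain ⟨u, -, hℓ⟩ := h.exists_smul_eq_and_forall_apply_eq i j
  ext x
  have hx := hℓ (coordEmb K (Pi.single x 1))
  simp only [hj, formOver_coordEmb] at hx
  refine (algebraMap ℚ K).injective (hx.symm.trans ?_)
  simp [formOver]

end Orbit

section Rational

theorem exists_coordEmb_mem_and_apply_eq {K : Type*} [Field K] [TopologicalSpace K]
    [IsTopologicalRing K] [Algebra ℚ K] (hK : DenseRange (algebraMap ℚ K)) {r : ℕ}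
    {U : Set (Fin r → K)} (hU : IsOpen U) {L : Dual ℚ (Fin r → ℚ)} (hL : L ≠ 0) {w : Fin r → K}
    (hw : w ∈ U) {y : ℚ} (hy : formOver K L w = algebraMap ℚ K y) :
    ∃ x : Fin r → ℚ, coordEmb K x ∈ U ∧ L x = y := by
  obtain ⟨e, he⟩ : ∃ e, L e = 1 := LinearMap.surjective hL 1
  let P : (Fin r → K) → Fin r → K := fun v =>
    v - (formOver K L v - algebraMap ℚ K y) • coordEmb K e
  have hP : Continuous P := by
    have := LinearMap.continuous_on_pi (formOver K L)
    fun_prop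
  have hPw : P w ∈ U := by simpa [P, hy] using hw
  obtain ⟨v, hv⟩ := (DenseRange.piMap fun _ : Fin r => hK).exists_mem_open (hU.preimage hP)
    ⟨w, hPw⟩
  refine ⟨v - (L v - y) • e, ?_, by simp [he]⟩
  have hPv : coordEmb K (v - (L v - y) • e) = P (coordEmb K v) := by
    simp only [P]
    rw [formOver_coordEmb, ← map_sub, ← coordEmb_smul]
    exact map_sub (coordEmbLinear K r) v _
  rw [hPv]
  exact hv

theorem isOpen_of_span_padic_eq_top {p : ℕ} [hp : Fact p.Prime] {r : ℕ}
    {M : Submodule ℤ_[p] (Fin r → ℚ_[p])}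
    (hM : Submodule.span ℚ_[p] (M : Set (Fin r → ℚ_[p])) = ⊤) :
    IsOpen (M : Set (Fin r → ℚ_[p])) := by
  obtain ⟨k, hk⟩ := exists_forall_pow_nsmul_mem_of_fg hM
    (Submodule.IsLattice.fg (M := standardLattice p r))
  have hstd : (standardLattice p r : Set (Fin r → ℚ_[p])) ∈ 𝓝 0 := by
    refine Filter.mem_of_superset (ball_mem_nhds 0 one_pos) fun x hx => ?_
    exact mem_standardLattice.2 fun i => (norm_le_pi_norm x i).trans (mem_ball_zero_iff.1 hx).le
  have hpk : (p : ℚ_[p]) ^ k ≠ 0 := pow_ne_zero _ (Nat.cast_ne_zero.2 hp.out.ne_zero)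
  refine AddSubgroup.isOpen_of_mem_nhds M.toAddSubgroup (g := 0)
    (Filter.mem_of_superset ((set_smul_mem_nhds_zero_iff hpk).2 hstd) ?_)
  rintro _ ⟨x, hx, rfl⟩
  change (p : ℚ_[p]) ^ k • x ∈ M
  rw [← Nat.cast_pow, Nat.cast_smul_eq_nsmul]
  exact hk x hx

end Rational

theorem mem_of_forall_prime_exists_nsmul_mem {G : Type*} [AddCommGroup G] {A : AddSubgroup G}
    {x : G} (h : ∀ p : ℕ, p.Prime → ∃ m : ℕ, ¬ p ∣ m ∧ m • x ∈ A) : x ∈ A := by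
  rw [← QuotientAddGroup.eq_zero_iff, ← AddMonoid.addOrderOf_eq_one_iff,
    Nat.eq_one_iff_not_exists_prime_dvd]
  intro p hp hdvd
  obtain ⟨m, hm, hmx⟩ := h p hp
  refine hm (hdvd.trans (addOrderOf_dvd_of_nsmul_eq_zero ?_))
  rwa [← QuotientAddGroup.mk_nsmul, QuotientAddGroup.eq_zero_iff]

section GlobalLattice

variable {r n : ℕ} {Ω : ∀ (p : ℕ) [Fact p.Prime], Submodule ℤ_[p] (Fin r → ℚ_[p])}

theorem exists_not_dvd_and_nsmul_mem_globalLattice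
    (hΛ : Submodule.span ℚ ((globalLattice Ω).toIntSubmodule : Set (Fin r → ℚ)) = ⊤)
    {p : ℕ} [hp : Fact p.Prime] {x : Fin r → ℚ} (hx : coordEmb ℚ_[p] x ∈ Ω p) :
    ∃ m : ℕ, ¬ p ∣ m ∧ m • x ∈ globalLattice Ω := by
  obtain ⟨N, hN, hNx⟩ := exists_ne_zero_smul_mem_of_span_eq_top hΛ x
  have hNx : N.natAbs • x ∈ globalLattice Ω := by
    rw [← natCast_zsmul, ← Int.sign_mul_self_eq_natAbs, mul_smul]
    exact (globalLattice Ω).zsmul_mem hNx _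
  obtain ⟨a, m, hpm, hNm⟩ :=
    Nat.exists_eq_pow_mul_and_not_dvd (Int.natAbs_ne_zero.2 hN) p hp.out.ne_one
  refine ⟨m, hpm, fun q hq => ?_⟩
  rw [← coordEmbLinear_apply, map_nsmul, coordEmbLinear_apply]
  by_cases hqp : q = p
  · subst hqp
    exact (Ω q).nsmul_mem hx m
  · have hunit : IsUnit ((p ^ a : ℕ) : ℤ_[q]) := by
      rw [PadicInt.isUnit_iff, PadicInt.norm_natCast_eq_one_iff]
      exact ((Nat.coprime_primes hq.out hp.out).2 hqp).pow_right a
    have hmem := hNx q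
    rwa [hNm, mul_smul, ← coordEmbLinear_apply, map_nsmul, map_nsmul, coordEmbLinear_apply,
      ← Nat.cast_smul_eq_nsmul ℤ_[q] (p ^ a), (Ω q).smul_mem_iff_of_isUnit hunit] at hmem

variable {L : Fin n → Dual ℚ (Fin r → ℚ)}

theorem map_globalLattice_le_of_inSingleOrbit
    (hΩ : ∀ (p : ℕ) [Fact p.Prime], Submodule.span ℚ_[p] (Ω p : Set (Fin r → ℚ_[p])) = ⊤)
    (hΛ : Submodule.span ℚ ((globalLattice Ω).toIntSubmodule : Set (Fin r → ℚ)) = ⊤)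
    (hL : ∀ (p : ℕ) [Fact p.Prime],
      InSingleOrbit (Ω p : Set (Fin r → ℚ_[p])) fun i => formOver ℚ_[p] (L i)) (i j : Fin n) :
    (globalLattice Ω).toIntSubmodule.map ((L i).restrictScalars ℤ) ≤
      (globalLattice Ω).toIntSubmodule.map ((L j).restrictScalars ℤ) := by
  by_cases hj : L j = 0
  · rw [hj, (hL 2).eq_zero_of_eq_zero hj]
  rintro _ ⟨x, hx, rfl⟩
  rw [← Submodule.mem_toAddSubgroup]
  refine mem_of_forall_prime_exists_nsmul_mem fun p hp => ?_
  have : Fact p.Prime := ⟨hp⟩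
  obtain ⟨w, hw, hwx⟩ := (hL p).exists_mem_apply_eq i j (hx p)
  rw [formOver_coordEmb] at hwx
  obtain ⟨x', hx', hLx'⟩ := exists_coordEmb_mem_and_apply_eq (Padic.denseRange_ratCast p)
    (isOpen_of_span_padic_eq_top (hΩ p)) hj hw hwx
  obtain ⟨m, hm, hmx'⟩ := exists_not_dvd_and_nsmul_mem_globalLattice hΛ hx'
  exact ⟨m, hm, m • x', hmx', (map_nsmul _ m x').trans (congrArg (m • ·) hLx')⟩

theorem map_globalLattice_eq_of_inSingleOrbit
    (hΩ : ∀ (p : ℕ) [Fact p.Prime], Submodule.span ℚ_[p] (Ω p : Set (Fin r → ℚ_[p])) = ⊤)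
    (hΛ : Submodule.span ℚ ((globalLattice Ω).toIntSubmodule : Set (Fin r → ℚ)) = ⊤)
    (hL : ∀ (p : ℕ) [Fact p.Prime],
      InSingleOrbit (Ω p : Set (Fin r → ℚ_[p])) fun i => formOver ℚ_[p] (L i)) (i j : Fin n) :
    (globalLattice Ω).toIntSubmodule.map ((L i).restrictScalars ℤ) =
      (globalLattice Ω).toIntSubmodule.map ((L j).restrictScalars ℤ) :=
  (map_globalLattice_le_of_inSingleOrbit hΩ hΛ hL i j).antisymm
    (map_globalLattice_le_of_inSingleOrbit hΩ hΛ hL j i)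

end GlobalLattice

/-! ### Ellipsoids and uniform distribution -/

section Ellipsoid

theorem convexOn_quadraticForm_of_nonneg {V : Type*} [AddCommGroup V] [Module ℝ V]
    {Q : QuadraticForm ℝ V} (hQ : ∀ x, 0 ≤ Q x) : ConvexOn ℝ Set.univ Q := by
  refine ⟨convex_univ, fun x _ y _ a b ha hb hab => ?_⟩
  have hcomb : Q (a • x + b • y) =
      a * a * Q x + b * b * Q y + a * b * QuadraticMap.polar Q x y := by
    rw [QuadraticMap.map_add Q, QuadraticMap.map_smul, QuadraticMap.map_smul,
      QuadraticMap.polar_smul_left, QuadraticMap.polar_smul_right]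
    simp only [smul_eq_mul]
    ring
  have hsub : Q (x - y) = Q x + Q y - QuadraticMap.polar Q x y := by
    rw [sub_eq_add_neg, QuadraticMap.map_add Q, QuadraticMap.map_neg, QuadraticMap.polar_neg_right]
    ring
  obtain rfl : b = 1 - a := by linarith
  have hdefect : a * Q x + (1 - a) * Q y - Q (a • x + (1 - a) • y) = a * (1 - a) * Q (x - y) := by
    rw [hcomb, hsub]
    ring
  have := mul_nonneg (mul_nonneg ha hb) (hQ (x - y))
  simp only [smul_eq_mul]
  linarith

variable {E : Type*} [NormedAddCommGroup E] [NormedSpace ℝ E] [FiniteDimensional ℝ E]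

theorem continuous_quadraticForm (Q : QuadraticForm ℝ E) : Continuous Q := by
  have h : ∀ x, Q x = (QuadraticMap.associated (R := ℝ) Q).toContinuousBilinearMap x x := fun x =>
    (QuadraticMap.associated_eq_self_apply ℝ Q x).symm
  rw [funext h]
  fun_prop

theorem exists_mul_norm_sq_le_quadraticForm {Q : QuadraticForm ℝ E} (hQ : Q.PosDef) :
    ∃ c > 0, ∀ x, c * ‖x‖ ^ 2 ≤ Q x := by
  obtain ⟨c, hc, hcQ⟩ : ∃ c > 0, ∀ x ∈ sphere (0 : E) 1, c ≤ Q x :=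
    (isCompact_sphere 0 1).exists_forall_le' (continuous_quadraticForm Q).continuousOn
      fun x hx => hQ x (ne_of_mem_sphere hx one_ne_zero)
  refine ⟨c, hc, fun x => ?_⟩
  rcases eq_or_ne x 0 with rfl | hx
  · simp
  have hnorm : ‖x‖ ≠ 0 := norm_ne_zero_iff.2 hx
  have hunit := hcQ (‖x‖⁻¹ • x) (by simp [norm_smul, hnorm])
  rw [QuadraticMap.map_smul, smul_eq_mul] at hunit
  calc c * ‖x‖ ^ 2 ≤ ‖x‖⁻¹ * ‖x‖⁻¹ * Q x * ‖x‖ ^ 2 := by gcongr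
    _ = Q x := by field_simp

theorem isBounded_quadraticForm_le {Q : QuadraticForm ℝ E} (hQ : Q.PosDef) (a : ℝ) :
    Bornology.IsBounded {x | Q x ≤ a} := by
  obtain ⟨c, hc, hcQ⟩ := exists_mul_norm_sq_le_quadraticForm hQ
  refine isBounded_iff_forall_norm_le.2 ⟨√(a / c), fun x hx => Real.le_sqrt_of_sq_le ?_⟩
  rw [le_div_iff₀' hc]
  exact (hcQ x).trans hx

variable {r : ℕ} {Q : QuadraticForm ℝ (Fin r → ℝ)} {W : Set (Fin r → ℝ)}

theorem IsEllipsoidOf.convex (hW : IsEllipsoidOf Q W) (hQ : Q.PosDef) : Convex ℝ W := by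
  have hconv := convexOn_quadraticForm_of_nonneg hQ.nonneg
  rcases hW with rfl | rfl
  · simpa only [Set.mem_univ, true_and] using hconv.convex_le 1
  · simpa only [Set.mem_univ, true_and] using hconv.convex_lt 1

theorem IsEllipsoidOf.isBounded (hW : IsEllipsoidOf Q W) (hQ : Q.PosDef) :
    Bornology.IsBounded W := by
  refine (isBounded_quadraticForm_le hQ 1).subset ?_
  rcases hW with rfl | rfl
  · exact subset_rfl
  · exact fun x (hx : Q x < 1) => hx.le

theorem IsEllipsoidOf.mem_nhds_zero (hW : IsEllipsoidOf Q W) : W ∈ 𝓝 0 := by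
  have hopen : {x | Q x < 1} ∈ 𝓝 0 :=
    (isOpen_lt (continuous_quadraticForm Q) continuous_const).mem_nhds (by simp)
  rcases hW with rfl | rfl
  · exact Filter.mem_of_superset hopen fun x (hx : Q x < 1) => hx.le
  · exact hopen

end Ellipsoid

theorem uniformOn_real_eq_ncard_div {α : Type*} [MeasurableSpace α] [MeasurableSingletonClass α]
    {S : Set α} (hS : S.Finite) (T : Set α) :
    (ProbabilityTheory.uniformOn S).real T = (S ∩ T).ncard / S.ncard := by
  rw [Measure.real, ProbabilityTheory.uniformOn, ProbabilityTheory.cond_apply hS.measurableSet,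
    Measure.count_apply_finite _ hS, Measure.count_apply_finite _ (hS.inter_of_left T),
    Set.ncard_eq_toFinset_card S hS, Set.ncard_eq_toFinset_card _ (hS.inter_of_left T),
    ENNReal.toReal_mul, ENNReal.toReal_inv, ENNReal.toReal_natCast, ENNReal.toReal_natCast,
    div_eq_inv_mul]

section RatPoints

variable {r : ℕ} {Ω : ∀ (p : ℕ) [Fact p.Prime], Submodule ℤ_[p] (Fin r → ℚ_[p])}
  {W : Set (Fin r → ℝ)}

theorem zero_mem_ratPoints (h0 : W ∈ 𝓝 0) (D : ℝ) : 0 ∈ ratPoints Ω W D := by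
  refine ⟨zero_mem (globalLattice Ω), Set.mem_smul_set.2 ⟨0, mem_of_mem_nhds h0, ?_⟩⟩
  rw [smul_zero]
  exact (map_zero (coordEmbLinear ℝ r)).symm

theorem ncard_ratPoints (D : ℝ) :
    (ratPoints Ω W D).ncard =
      ((realLattice (globalLattice Ω).toIntSubmodule : Set (Fin r → ℝ)) ∩ D • W).ncard := by
  rw [ncard_realLattice_inter]
  rfl

theorem ncard_ratPoints_inter_fiber (D : ℝ) (L : Dual ℚ (Fin r → ℚ)) (y : ℚ) :
    (ratPoints Ω W D ∩ {x | L x = y}).ncard =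
      ((realLattice (globalLattice Ω).toIntSubmodule : Set (Fin r → ℝ)) ∩ D • W ∩
        {x | formOver ℝ L x = y}).ncard := by
  rw [Set.inter_assoc, ncard_realLattice_inter, Set.preimage_inter, ← Set.inter_assoc]
  have hfiber : coordEmb ℝ ⁻¹' {x | formOver ℝ L x = y} = {x | L x = y} :=
    Set.ext fun x => by simp [formOver_coordEmb]
  rw [hfiber]
  rfl

variable [hΛ : Submodule.IsLattice ℚ (globalLattice Ω).toIntSubmodule]

theorem finite_ratPoints (hb : Bornology.IsBounded W) (D : ℝ) : (ratPoints Ω W D).Finite := by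
  have hfin := finite_inter_of_isBounded (realLattice (globalLattice Ω).toIntSubmodule)
    (hb.smul₀ D)
  refine (hfin.preimage coordEmb_injective.injOn).subset fun x hx => ?_
  exact ⟨⟨x, hx.1, rfl⟩, hx.2⟩

theorem exists_forall_abs_uniformOn_ratPoints_sub_le (hc : Convex ℝ W)
    (hb : Bornology.IsBounded W) (h0 : W ∈ 𝓝 0) {L L' : Dual ℚ (Fin r → ℚ)}
    (hL : (globalLattice Ω).toIntSubmodule.map (L'.restrictScalars ℤ) =
      (globalLattice Ω).toIntSubmodule.map (L.restrictScalars ℤ))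
    {u : (Fin r → ℝ) ≃ₗ[ℝ] (Fin r → ℝ)} (hu : u • W = W)
    (hLu : ∀ x, formOver ℝ L' (u x) = formOver ℝ L x) :
    ∃ C : ℝ, ∀ D : ℝ, 0 < D → ∀ y : ℚ,
      |(ProbabilityTheory.uniformOn (ratPoints Ω W D)).real {x | L x = y} -
        (ProbabilityTheory.uniformOn (ratPoints Ω W D)).real {x | L' x = y}| ≤ C / D ^ 2 := by
  let Γ := realLattice (globalLattice Ω).toIntSubmodule
  obtain ⟨c, hc0, hcount⟩ := exists_forall_mul_pow_le_ncard_inter (Γ := Γ) hb h0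
  obtain ⟨C, hC0, hC⟩ := exists_forall_abs_sub_ncard_inter_fiber_le hc hb h0 hu hLu
    (isPrincipal_map_formOver_realLattice hΛ.fg L)
    (by rw [map_formOver_realLattice, map_formOver_realLattice, hL])
  refine ⟨max (C / c) 1, fun D hD y => ?_⟩
  rcases le_total D 1 with hD1 | hD1
  · refine (abs_sub_le_of_nonneg_of_le measureReal_nonneg measureReal_le_one measureReal_nonneg
      measureReal_le_one).trans ?_
    rw [one_le_div (by positivity)]
    exact (pow_le_one₀ hD.le hD1).trans (le_max_right _ _)
  · have hN : c * D ^ r ≤ (ratPoints Ω W D).ncard := by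
      simpa only [ncard_ratPoints, finrank_fin_fun] using hcount D hD
    have hdiff : |((ratPoints Ω W D ∩ {x | L x = y}).ncard : ℝ) -
        (ratPoints Ω W D ∩ {x | L' x = y}).ncard| ≤ C * (D ^ r / D ^ 2) := by
      simpa only [ncard_ratPoints_inter_fiber, finrank_fin_fun] using hC D hD1 y
    rw [uniformOn_real_eq_ncard_div (finite_ratPoints hb D),
      uniformOn_real_eq_ncard_div (finite_ratPoints hb D), ← sub_div, abs_div, Nat.abs_cast]
    calc _ ≤ C * (D ^ r / D ^ 2) / (c * D ^ r) := by gcongr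
      _ = C / c / D ^ 2 := by field_simp
      _ ≤ max (C / c) 1 / D ^ 2 := by gcongr; exact le_max_left _ _

end RatPoints

end NonDet

theorem mainTheorem7_general {r n : ℕ} (L : Fin n → Module.Dual ℚ (Fin r → ℚ))
    (Ω : ∀ (p : ℕ) [Fact p.Prime], Submodule ℤ_[p] (Fin r → ℚ_[p]))
    (hΩ_lattice : ∀ (p : ℕ) [Fact p.Prime], Submodule.IsLattice ℚ_[p] (Ω p))
    (hΩ_standard : {p : ℕ | ∃ _ : Fact p.Prime, Ω p ≠ NonDet.standardLattice p r}.Finite)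
    (hΩ_orbit : ∀ (p : ℕ) [Fact p.Prime],
      NonDet.InSingleOrbit (Ω p : Set (Fin r → ℚ_[p])) fun i => NonDet.formOver ℚ_[p] (L i))
    (W : Set (Fin r → ℝ)) (hW_convex : Convex ℝ W) (hW_bounded : Bornology.IsBounded W)
    (hW_nhds : W ∈ nhds 0)
    (hW_orbit : NonDet.InSingleOrbit W fun i => NonDet.formOver ℝ (L i)) :
    (∀ D : ℝ, 0 < D →
      (NonDet.ratPoints Ω W D).Finite ∧ (NonDet.ratPoints Ω W D).Nonempty) ∧
    ∃ C : ℝ, ∀ D : ℝ, 0 < D → ∀ (i j : Fin n) (y : ℚ),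
      |(ProbabilityTheory.uniformOn (NonDet.ratPoints Ω W D)).real {x | L i x = y} -
        (ProbabilityTheory.uniformOn (NonDet.ratPoints Ω W D)).real {x | L j x = y}| ≤
          C / D ^ 2 := by
  have hΛ := NonDet.isLattice_globalLattice hΩ_lattice hΩ_standard
  refine ⟨fun D _ => ⟨NonDet.finite_ratPoints hW_bounded D, 0,
    NonDet.zero_mem_ratPoints hW_nhds D⟩, ?_⟩
  have hpair : ∀ ij : Fin n × Fin n, ∃ C : ℝ, ∀ D : ℝ, 0 < D → ∀ y : ℚ,
      |(ProbabilityTheory.uniformOn (NonDet.ratPoints Ω W D)).real {x | L ij.1 x = y} -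
        (ProbabilityTheory.uniformOn (NonDet.ratPoints Ω W D)).real {x | L ij.2 x = y}| ≤
          C / D ^ 2 := by
    rintro ⟨i, j⟩
    obtain ⟨u, hu, hLu⟩ := hW_orbit.exists_smul_eq_and_forall_apply_eq i j
    exact NonDet.exists_forall_abs_uniformOn_ratPoints_sub_le hW_convex hW_bounded hW_nhds
      (NonDet.map_globalLattice_eq_of_inSingleOrbit (fun p _ => (hΩ_lattice p).span_eq_top)
        hΛ.span_eq_top hΩ_orbit j i) hu hLu
  choose C hC using hpair
  obtain ⟨M, hM⟩ := Finite.exists_le C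
  refine ⟨M, fun D hD i j y => (hC (i, j) D hD y).trans ?_⟩
  gcongr
  exact hM (i, j)

theorem mainTheorem7 {r n : ℕ} (L : Fin n → Module.Dual ℚ (Fin r → ℚ))
    (Ω : ∀ (p : ℕ) [Fact p.Prime], Submodule ℤ_[p] (Fin r → ℚ_[p]))
    (hΩ_lattice : ∀ (p : ℕ) [Fact p.Prime], Submodule.IsLattice ℚ_[p] (Ω p))
    (hΩ_standard : {p : ℕ | ∃ _ : Fact p.Prime, Ω p ≠ NonDet.standardLattice p r}.Finite)
    (hΩ_orbit : ∀ (p : ℕ) [Fact p.Prime],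
      NonDet.InSingleOrbit (Ω p : Set (Fin r → ℚ_[p])) fun i => NonDet.formOver ℚ_[p] (L i))
    (Q : QuadraticForm ℝ (Fin r → ℝ)) (hQ_pos : Q.PosDef) (hQ_rat : NonDet.IsDefinedOverRat Q)
    (Ωreal : Set (Fin r → ℝ)) (hΩreal : NonDet.IsEllipsoidOf Q Ωreal)
    (hΩreal_orbit : NonDet.InSingleOrbit Ωreal fun i => NonDet.formOver ℝ (L i)) :
    (∀ D : ℝ, 0 < D →
      (NonDet.ratPoints Ω Ωreal D).Finite ∧ (NonDet.ratPoints Ω Ωreal D).Nonempty) ∧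
    ∃ C : ℝ, ∀ D : ℝ, 0 < D → ∀ (i j : Fin n) (y : ℚ),
      |(ProbabilityTheory.uniformOn (NonDet.ratPoints Ω Ωreal D)).real {x | L i x = y} -
        (ProbabilityTheory.uniformOn (NonDet.ratPoints Ω Ωreal D)).real {x | L j x = y}| ≤
          C / D ^ 2 :=
  mainTheorem7_general L Ω hΩ_lattice hΩ_standard hΩ_orbit Ωreal (hΩreal.convex hQ_pos)
    (hΩreal.isBounded hQ_pos) hΩreal.mem_nhds_zero hΩreal_orbit
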